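/- Let $r>1$ and $\mu>0$. For a bounded measurable $2\pi$-periodic function $f:\mathbb{R}\to\mathbb{R}$ write $\hat f(k)=\frac{1}{2\pi}\int_{-\pi}^{\pi}f(x)e^{-ikx}\,dx$ and $$L_rf(x)=\sum_{k\in\mathbb{Z}\setminus\{0\}}|k|^{-r}\hat f(k)e^{ikx}.$$ Let $\varphi:\mathbb{R}\to\mathbb{R}$ be a bounded measurable $2\pi$-periodic function satisfying, for every $x\in\mathbb{R}$, the steady equation $$-\mu\varphi(x)+L_r\varphi(x)+\tfrac12\varphi(x)^2-\tfrac12\widehat{\varphi^2}(0)=0.$$ Suppose that $\varphi$ is even, that $\varphi$ is nondecreasing on $[-\pi,0]$, that $\varphi\le\mu$ on $\mathbb{R}$, and that $\varphi(0)=\mu$. Then: (i) $\varphi$ is of class $C^\infty$ on $\mathbb{R}\setminus 2\pi\mathbb{Z}$ (that is, on $\mathbb{T}\setminus\{0\}$, where $\mathbb{T}=\mathbb{R}/2\pi\mathbb{Z}$), and $\varphi$ is strictly increasing on $(-\pi,0)$; (ii) $\varphi$ is Lipschitz continuous on $\mathbb{R}$ and has zero mean, $\int_{-\pi}^{\pi}\varphi(x)\,dx=0$;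 (iii) $\varphi$ is exactly Lipschitz at the crest: there are constants $c,C,\delta>0$ such that $c|x|\le\mu-\varphi(x)\le C|x|$ whenever $|x|<\delta$. -/

import Mathlib

open Set
open scoped ContDiff Real

/-- The `k`-th Fourier coefficient `(1 / 2π) ∫_{-π}^{π} f(x) e^{-ikx} dx` of a real function on the
torus `[-π, π]` (functions on the torus are `2π`-periodic functions on the line). -/
noncomputable def torusCoeff (f : ℝ → ℝ) (k : ℤ) : ℂ :=
  fourierCoeffOn (neg_lt_self Real.pi_pos) (fun x => (f x : ℂ)) k

/-- The homogeneous symbol `|k|^{-r}` for `k ≠ 0`, and `0` for `k = 0`. -/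
noncomputable def homSymbol (r : ℝ) (k : ℤ) : ℝ :=
  if k = 0 then 0 else |(k : ℝ)| ^ (-r)

/-- The Fourier multiplier `L_r f (x) = ∑_{k ≠ 0} |k|^{-r} f̂(k) e^{ikx}`. For `r > 1` and `f`
bounded and measurable the series converges absolutely; its value is a real number. -/
noncomputable def Lmult (r : ℝ) (f : ℝ → ℝ) (x : ℝ) : ℂ :=
  ∑' k : ℤ, (homSymbol r k : ℂ) * torusCoeff f k * Complex.exp (Complex.I * k * x)

/-- `φ` is a bounded `2π`-periodic solution, with wave speed `μ`, of the steady equation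
`-μ φ + L_r φ + φ² / 2 - (φ²)^(0) / 2 = 0`, where `(φ²)^(0)` is the mean of `φ²`. -/
structure IsSteadySolution (r μ : ℝ) (φ : ℝ → ℝ) : Prop where
  measurable : Measurable φ
  bounded : ∃ M : ℝ, ∀ x, |φ x| ≤ M
  periodic : Function.Periodic φ (2 * π)
  equation : ∀ x : ℝ,
    -(μ : ℂ) * (φ x : ℂ) + Lmult r φ x + (1 / 2) * (φ x : ℂ) ^ 2
      - (1 / 2) * torusCoeff (fun y => φ y ^ 2) 0 = 0

/-! `L_r` is convolution over a period with the even kernel K(s) = (1/π) ∑ n^{-r} cos(ns).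
Subtracting the equation at the crest and writing u = μ - φ ≥ 0 gives u² = 2(K*u - (K*u)(0)). The
regularity of u is therefore that of K*u, except where the square root degenerates, at the crest.

The key identity is K*u(m+h) - K*u(m-h) = ∫_0^π (K(y-m) - K(y+m)) (u(y+h) - u(y-h)) dy, valid for
continuous, even, periodic u. For m, h in [0, π] both factors are nonnegative: the second by
monotonicity of u, the first because K is a positive superposition of Poisson kernels minus
constants. From this explicit form come two bounds for y, h in [0, π]: K(y-h) - K(y+h) is at least c
sin y sin h, and at most c h |y-h|^{-β} for some β < 1.

The lower bound gives K*u(m+h) - K*u(m-h) ≥ c sin m sin h, hence strict monotonicity and, for m = h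
= x/2, the linear lower bound u(x) ≥ cx on [0, π]. For the linear upper bound let A = max u/(x+ε).
The upper kernel bound yields an inequality quadratic in A on the left and linear on the right, so A
is bounded uniformly in ε. Inserting u ≤ Ax again gives (u(y) - u(x))(u(y) + u(x)) ≤ C(y-x)(y+x),
and dividing by u(x) + u(y) ≥ a(x+y) gives the Lipschitz bound (`exists_mul_le`, `exists_le_mul`,
`exists_sub_le_mul_sub`).

Away from the crest u > 0, and u = √(2(K*u - (K*u)(0))) can be bootstrapped: K is smooth off 2πℤ and
K' is integrable, so convolution gains one derivative locally (`contDiffAt_succ_torusConv`). The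
zero mean follows by integrating the equation, since K has mean zero and μ > 0. -/

open MeasureTheory Filter Topology

/-! ### The polylogarithm as a Bose integral. -/

theorem integrableOn_rpow_mul_exp_neg_mul {s b : ℝ} (hs : -1 < s) (hb : 0 < b) :
    IntegrableOn (fun t : ℝ => t ^ s * Real.exp (-b * t)) (Ioi 0) := by
  simpa using integrableOn_rpow_mul_exp_neg_mul_rpow (p := 1) hs one_pos hb

/-- The integrand `t^{r-1} z / (e^t - z)` of the integral representation of the polylogarithm. -/
noncomputable def boseIntegrand (r : ℝ) (z : ℂ) (t : ℝ) : ℂ :=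
  ((t ^ (r - 1) : ℝ) : ℂ) * (z / ((Real.exp t : ℝ) - z))

/-- `∫_0^∞ t^{r-1} z / (e^t - z) dt = Γ(r) Li_r(z)`. -/
noncomputable def boseIntegral (r : ℝ) (z : ℂ) : ℂ := ∫ t in Ioi (0 : ℝ), boseIntegrand r z t

theorem mul_exp_half_le_exp_sub_one (t : ℝ) (ht : 0 ≤ t) :
    t * Real.exp (t / 2) ≤ Real.exp t - 1 := by
  have h1 : t / 2 ≤ Real.sinh (t / 2) := Real.self_le_sinh_iff.2 (by positivity)
  rw [Real.sinh_eq] at h1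
  have h2 : Real.exp t = Real.exp (t / 2) * Real.exp (t / 2) := by
    rw [← Real.exp_add]; ring_nf
  have h3 : Real.exp (-(t / 2)) * Real.exp (t / 2) = 1 := by
    rw [← Real.exp_add]; simp
  nlinarith [Real.exp_pos (t / 2)]

theorem exp_sub_one_le_norm_exp_sub {z : ℂ} (hz : ‖z‖ ≤ 1) (t : ℝ) :
    Real.exp t - 1 ≤ ‖((Real.exp t : ℝ) : ℂ) - z‖ := by
  have h := norm_sub_norm_le ((Real.exp t : ℝ) : ℂ) z
  rw [Complex.norm_real, Real.norm_of_nonneg (Real.exp_pos t).le] at h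
  linarith

theorem aestronglyMeasurable_boseIntegrand (r : ℝ) (z : ℂ) (μ : Measure ℝ) :
    AEStronglyMeasurable (boseIntegrand r z) μ := by
  apply Measurable.aestronglyMeasurable
  unfold boseIntegrand
  fun_prop

theorem norm_boseIntegrand {r t : ℝ} (ht : 0 < t) (z : ℂ) :
    ‖boseIntegrand r z t‖ = t ^ (r - 1) * (‖z‖ / ‖((Real.exp t : ℝ) : ℂ) - z‖) := by
  rw [boseIntegrand, norm_mul, norm_div, Complex.norm_real,
    Real.norm_of_nonneg (Real.rpow_nonneg ht.le _)]

/-- On the closed disc |e^t - z| ≥ e^t - 1 ≥ t e^{t/2}, so the integrand is dominated by t^{r-2}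
e^{-t/2}. This is integrable at 0 because r > 1, even at the boundary point z = 1. -/
theorem integrableOn_boseIntegrand {r : ℝ} (hr : 1 < r) {z : ℂ} (hz : ‖z‖ ≤ 1) :
    IntegrableOn (boseIntegrand r z) (Ioi 0) := by
  refine Integrable.mono' (integrableOn_rpow_mul_exp_neg_mul (s := r - 2) (b := 1 / 2)
    (by linarith) (by norm_num)) (aestronglyMeasurable_boseIntegrand r z _) ?_
  refine (ae_restrict_iff' measurableSet_Ioi).2 (Eventually.of_forall fun t ht => ?_)
  have ht : 0 < t := ht
  have h1 := mul_exp_half_le_exp_sub_one t ht.le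
  have h2 := exp_sub_one_le_norm_exp_sub hz t
  have h3 : 0 < t * Real.exp (t / 2) := by positivity
  rw [norm_boseIntegrand ht]
  have h4 : t ^ (r - 1) = t ^ (r - 2) * t := by
    rw [← Real.rpow_add_one ht.ne']; ring_nf
  have h5 : ‖z‖ / ‖((Real.exp t : ℝ) : ℂ) - z‖ ≤ 1 / (t * Real.exp (t / 2)) :=
    div_le_div₀ zero_le_one hz h3 (h1.trans h2)
  calc _ ≤ t ^ (r - 1) * (1 / (t * Real.exp (t / 2))) := by gcongr
    _ = t ^ (r - 2) * Real.exp (-(1 / 2) * t) := by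
      rw [h4, show -(1 / 2) * t = -(t / 2) by ring, Real.exp_neg]
      field_simp

theorem hasSum_pow_mul_exp_neg {z : ℂ} (hz : ‖z‖ ≤ 1) {t : ℝ} (ht : 0 < t) :
    HasSum (fun n : ℕ => z ^ (n + 1) * (Real.exp (-((n : ℝ) + 1) * t) : ℝ))
      (z / ((Real.exp t : ℝ) - z)) := by
  set q : ℂ := z * (Real.exp (-t) : ℝ) with hq
  have hq1 : ‖q‖ < 1 := by
    rw [hq, norm_mul, Complex.norm_real, Real.norm_of_nonneg (Real.exp_pos _).le]
    have : Real.exp (-t) < 1 := by rw [Real.exp_lt_one_iff]; linarith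
    nlinarith [norm_nonneg z, Real.exp_pos (-t)]
  have h := (hasSum_geometric_of_norm_lt_one hq1).mul_left q
  have he : ((Real.exp t : ℝ) : ℂ) * (Real.exp (-t) : ℝ) = 1 := by
    rw [← Complex.ofReal_mul, ← Real.exp_add]; simp
  have hne : ((Real.exp t : ℝ) : ℂ) - z ≠ 0 := by
    rw [← norm_pos_iff]
    have h2 := exp_sub_one_le_norm_exp_sub hz t
    have : 1 < Real.exp t := Real.one_lt_exp_iff.2 ht
    linarith
  have hne' : 1 - q ≠ 0 := by
    intro h0
    have : q = 1 := by linear_combination -h0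
    rw [this] at hq1; simp at hq1
  have e : (fun n : ℕ => z ^ (n + 1) * ((Real.exp (-((n : ℝ) + 1) * t) : ℝ) : ℂ)) =
      fun n => q * q ^ n := by
    funext n
    rw [hq, mul_pow, ← Complex.ofReal_pow, ← Real.exp_nat_mul,
      show -((n : ℝ) + 1) * t = (n : ℝ) * -t + -t by ring, Real.exp_add]
    push_cast; ring
  have e' : z / (((Real.exp t : ℝ) : ℂ) - z) = q * (1 - q)⁻¹ := by
    rw [← div_eq_mul_inv, div_eq_div_iff hne hne', hq]
    linear_combination -z * he
  rw [e, e']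
  exact h

theorem mellin_bose_eq (r : ℝ) (z : ℂ) :
    mellin (fun t : ℝ => z / ((Real.exp t : ℝ) - z)) (r : ℂ) = boseIntegral r z := by
  rw [mellin, boseIntegral]
  refine setIntegral_congr_fun measurableSet_Ioi fun t ht => ?_
  have ht : 0 < t := ht
  simp only [boseIntegrand, smul_eq_mul]
  rw [Complex.ofReal_cpow ht.le]
  push_cast; rfl

theorem summable_one_div_add_one_rpow {r : ℝ} (hr : 1 < r) :
    Summable (fun n : ℕ => 1 / ((n : ℝ) + 1) ^ r) := by
  refine ((Real.summable_one_div_nat_add_rpow 1 r).2 hr).congr fun n => ?_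
  rw [abs_of_pos (by positivity)]

/-- Expand z/(e^t - z) as a geometric series in z e^{-t} and take Mellin transforms term by term; r
> 1 gives absolute convergence up to |z| = 1. -/
theorem hasSum_boseIntegral {r : ℝ} (hr : 1 < r) {z : ℂ} (hz : ‖z‖ ≤ 1) :
    HasSum (fun n : ℕ => z ^ (n + 1) / ((((n : ℝ) + 1) ^ r : ℝ) : ℂ))
      (boseIntegral r z / (Real.Gamma r : ℝ)) := by
  have h := hasSum_mellin (ι := ℕ) (a := fun n => z ^ (n + 1)) (p := fun n => (n : ℝ) + 1)
    (F := fun t : ℝ => z / ((Real.exp t : ℝ) - z)) (s := (r : ℂ)) (fun i => Or.inr (by positivity))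
    (by simpa using by linarith) (fun t ht => hasSum_pow_mul_exp_neg hz ht) ?_
  · rw [mellin_bose_eq] at h
    have hG : ((Real.Gamma r : ℝ) : ℂ) ≠ 0 :=
      Complex.ofReal_ne_zero.2 (Real.Gamma_pos_of_pos (by linarith)).ne'
    have e : (fun n : ℕ => z ^ (n + 1) / ((((n : ℝ) + 1) ^ r : ℝ) : ℂ)) = fun n : ℕ =>
        Complex.Gamma r * z ^ (n + 1) / (((n : ℝ) + 1 : ℝ) : ℂ) ^ (r : ℂ) /
          ((Real.Gamma r : ℝ) : ℂ) := by
      funext n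
      rw [Complex.Gamma_ofReal, Complex.ofReal_cpow (by positivity)]
      field_simp
    rw [e]
    exact h.div_const _
  · refine Summable.of_nonneg_of_le (fun n => by positivity) (fun n => ?_)
      (summable_one_div_add_one_rpow hr)
    simp only [Complex.ofReal_re, norm_pow]
    gcongr
    exact pow_le_one₀ (norm_nonneg _) hz

/-- With s = e^{-t} one has e^t - z = e^t (1 - sz). The slit plane is star-convex about 1, so 1 - s
z₀ does not vanish for s in [0, 1]; compactness makes this uniform in s and stable under small
changes of z₀. -/
theorem exists_mul_exp_le_norm_exp_sub {z₀ : ℂ} (h : 1 - z₀ ∈ Complex.slitPlane) :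
    ∃ c > 0, ∃ ε > 0, ∀ z ∈ Metric.ball z₀ ε, ∀ t : ℝ, 0 < t →
      c * Real.exp t ≤ ‖((Real.exp t : ℝ) : ℂ) - z‖ := by
  obtain ⟨s₀, hs₀, hmin⟩ := isCompact_Icc.exists_isMinOn (nonempty_Icc.2 (zero_le_one (α := ℝ)))
    (f := fun s : ℝ => ‖1 - (s : ℂ) * z₀‖) (by fun_prop)
  have hpos : 0 < ‖1 - (s₀ : ℂ) * z₀‖ := by
    rw [norm_pos_iff]
    have h1 := Complex.starConvex_one_slitPlane h (a := 1 - s₀) (b := s₀)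
      (by linarith [hs₀.2]) hs₀.1 (by ring)
    have h2 := Complex.slitPlane_ne_zero h1
    convert h2 using 1
    simp only [Complex.real_smul]; push_cast; ring
  set d := ‖1 - (s₀ : ℂ) * z₀‖ with hd
  refine ⟨d / 2, by positivity, d / 2, by positivity, fun z hz t ht => ?_⟩
  rw [Metric.mem_ball, dist_eq_norm] at hz
  set s := Real.exp (-t)
  have hs : s ∈ Icc (0 : ℝ) 1 := ⟨(Real.exp_pos _).le, by rw [Real.exp_le_one_iff]; linarith⟩
  have h1 : d ≤ ‖1 - (s : ℂ) * z₀‖ := hmin hs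
  have h2 : ‖1 - (s : ℂ) * z₀‖ ≤ ‖1 - (s : ℂ) * z‖ + d / 2 := by
    have : 1 - (s : ℂ) * z₀ = (1 - (s : ℂ) * z) + (s : ℂ) * (z - z₀) := by ring
    rw [this]
    refine (norm_add_le _ _).trans ?_
    rw [norm_mul, Complex.norm_real, Real.norm_of_nonneg hs.1]
    nlinarith [norm_nonneg (z - z₀), hs.1, hs.2]
  have he : ((Real.exp t : ℝ) : ℂ) * (s : ℂ) = 1 := by
    rw [← Complex.ofReal_mul, ← Real.exp_add]; simp
  have h3 : ((Real.exp t : ℝ) : ℂ) - z = ((Real.exp t : ℝ) : ℂ) * (1 - (s : ℂ) * z) := by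
    linear_combination z * he
  rw [h3, norm_mul, Complex.norm_real, Real.norm_of_nonneg (Real.exp_pos _).le, mul_comm]
  gcongr
  linarith

/-- This continues the polylogarithm analytically across the unit circle away from z = 1, which is
what makes the kernel smooth off 2πℤ. -/
theorem differentiableAt_boseIntegral {r : ℝ} (hr : 1 < r) {z₀ : ℂ}
    (h : 1 - z₀ ∈ Complex.slitPlane) : DifferentiableAt ℂ (boseIntegral r) z₀ := by
  obtain ⟨c, hc, ε, hε, hb⟩ := exists_mul_exp_le_norm_exp_sub h
  have key := hasDerivAt_integral_of_dominated_loc_of_deriv_le (𝕜 := ℂ)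
    (μ := volume.restrict (Ioi (0 : ℝ))) (F := fun z t => boseIntegrand r z t) (x₀ := z₀)
    (F' := fun z t => ((t ^ (r - 1) : ℝ) : ℂ) * ((Real.exp t : ℝ) / ((Real.exp t : ℝ) - z) ^ 2))
    (bound := fun t => (1 / c ^ 2) * (t ^ (r - 1) * Real.exp (-1 * t)))
    (Metric.ball_mem_nhds z₀ hε)
    (Eventually.of_forall fun z => aestronglyMeasurable_boseIntegrand r z _) ?_ ?_ ?_ ?_ ?_
  · exact key.2.differentiableAt
  · refine Integrable.mono' ((integrableOn_rpow_mul_exp_neg_mul (s := r - 1) (b := 1)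
      (by linarith) one_pos).const_mul (‖z₀‖ / c)) (aestronglyMeasurable_boseIntegrand r z₀ _) ?_
    refine (ae_restrict_iff' measurableSet_Ioi).2 (Eventually.of_forall fun t ht => ?_)
    have ht : 0 < t := ht
    rw [norm_boseIntegrand ht]
    have h1 := hb z₀ (Metric.mem_ball_self hε) t ht
    calc _ ≤ t ^ (r - 1) * (‖z₀‖ / (c * Real.exp t)) := by gcongr
      _ = _ := by rw [neg_one_mul, Real.exp_neg]; field_simp
  · apply Measurable.aestronglyMeasurable; fun_prop
  · refine (ae_restrict_iff' measurableSet_Ioi).2 (Eventually.of_forall fun t ht z hz => ?_)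
    have ht : 0 < t := ht
    have h1 := hb z hz t ht
    rw [norm_mul, norm_div, norm_pow, Complex.norm_real, Complex.norm_real,
      Real.norm_of_nonneg (Real.rpow_nonneg ht.le _), Real.norm_of_nonneg (Real.exp_pos t).le]
    calc _ ≤ t ^ (r - 1) * (Real.exp t / (c * Real.exp t) ^ 2) := by gcongr
      _ = _ := by rw [neg_one_mul, Real.exp_neg]; field_simp
  · exact (integrableOn_rpow_mul_exp_neg_mul (by linarith) one_pos).const_mul _
  · refine (ae_restrict_iff' measurableSet_Ioi).2 (Eventually.of_forall fun t ht z hz => ?_)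
    have h1 := hb z hz t ht
    have hne : ((Real.exp t : ℝ) : ℂ) - z ≠ 0 := by
      rw [← norm_pos_iff]; exact lt_of_lt_of_le (by positivity) h1
    have h2 := ((hasDerivAt_id z).div ((hasDerivAt_id z).const_sub ((Real.exp t : ℝ) : ℂ))
      hne).const_mul ((t ^ (r - 1) : ℝ) : ℂ)
    refine HasDerivAt.congr_deriv (f := fun x => boseIntegrand r x t) h2 ?_
    simp only [id]
    ring

theorem contDiffAt_boseIntegral {r : ℝ} (hr : 1 < r) {z₀ : ℂ}
    (h : 1 - z₀ ∈ Complex.slitPlane) {n : WithTop ℕ∞} : ContDiffAt ℂ n (boseIntegral r) z₀ := by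
  have hopen : IsOpen {z : ℂ | 1 - z ∈ Complex.slitPlane} :=
    Complex.isOpen_slitPlane.preimage (by fun_prop)
  exact (DifferentiableOn.contDiffOn (fun z hz =>
    (differentiableAt_boseIntegral hr hz).differentiableWithinAt) hopen).contDiffAt
    (hopen.mem_nhds h)

/-! ### The convolution kernel: series, symmetries, mean, smoothness off 2πℤ. -/

/-- The convolution kernel `(1/π) ∑_{n ≥ 1} n^{-r} cos (n s)` of `L_r`. -/
noncomputable def torusKernel (r s : ℝ) : ℝ :=
  (1 / (π * Real.Gamma r)) * (boseIntegral r (Complex.exp (s * Complex.I))).re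

theorem hasSum_torusKernel {r : ℝ} (hr : 1 < r) (s : ℝ) :
    HasSum (fun n : ℕ => (1 / π) * (Real.cos (((n : ℝ) + 1) * s) / ((n : ℝ) + 1) ^ r))
      (torusKernel r s) := by
  have h := (Complex.hasSum_re (hasSum_boseIntegral hr (z := Complex.exp (s * Complex.I))
    (Complex.norm_exp_ofReal_mul_I s).le)).mul_left (1 / π)
  have e : torusKernel r s =
      1 / π * (boseIntegral r (Complex.exp (s * Complex.I)) / (Real.Gamma r : ℝ)).re := by
    rw [torusKernel, Complex.div_ofReal_re]; field_simp
  rw [e]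
  have e2 : ∀ n : ℕ, Real.cos (((n : ℝ) + 1) * s) / ((n : ℝ) + 1) ^ r =
      (Complex.exp (s * Complex.I) ^ (n + 1) / ((((n : ℝ) + 1) ^ r : ℝ) : ℂ)).re := by
    intro n
    rw [Complex.div_ofReal_re, ← Complex.exp_nat_mul, ← Complex.exp_ofReal_mul_I_re]
    push_cast; ring_nf
  simpa only [e2] using h

theorem norm_torusKernel_term_le {r : ℝ} (n : ℕ) (s : ℝ) :
    ‖(1 / π) * (Real.cos (((n : ℝ) + 1) * s) / ((n : ℝ) + 1) ^ r)‖ ≤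
      (1 / π) * (1 / ((n : ℝ) + 1) ^ r) := by
  rw [norm_mul, norm_div (Real.cos _), Real.norm_of_nonneg (by positivity : (0 : ℝ) ≤ 1 / π),
    Real.norm_of_nonneg (by positivity : (0 : ℝ) ≤ ((n : ℝ) + 1) ^ r)]
  gcongr
  exact Real.abs_cos_le_one _

theorem continuous_torusKernel {r : ℝ} (hr : 1 < r) : Continuous (torusKernel r) := by
  have e : torusKernel r = fun s => ∑' n : ℕ,
      (1 / π) * (Real.cos (((n : ℝ) + 1) * s) / ((n : ℝ) + 1) ^ r) :=
    funext fun s => (hasSum_torusKernel hr s).tsum_eq.symm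
  rw [e]
  refine continuous_tsum (fun n => by fun_prop)
    ((summable_one_div_add_one_rpow hr).mul_left (1 / π)) fun n s => ?_
  exact norm_torusKernel_term_le n s

theorem boseIntegral_exp_neg (r s : ℝ) : boseIntegral r (Complex.exp ((-s : ℝ) * Complex.I)) =
    (starRingEnd ℂ) (boseIntegral r (Complex.exp (s * Complex.I))) := by
  have h : Complex.exp ((-s : ℝ) * Complex.I) = (starRingEnd ℂ) (Complex.exp (s * Complex.I)) := by
    rw [← Complex.exp_conj]; simp
  rw [h, boseIntegral, boseIntegral, ← integral_conj]
  congr 1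
  funext t
  simp only [boseIntegrand, map_mul, map_div₀, map_sub, Complex.conj_ofReal]

theorem torusKernel_neg (r s : ℝ) : torusKernel r (-s) = torusKernel r s := by
  rw [torusKernel, torusKernel, boseIntegral_exp_neg, Complex.conj_re]

theorem periodic_torusKernel (r : ℝ) : Function.Periodic (torusKernel r) (2 * π) := by
  intro s
  rw [torusKernel, torusKernel]
  congr 3
  push_cast
  rw [add_mul, Complex.exp_periodic _]

theorem integral_torusKernel {r : ℝ} (hr : 1 < r) : ∫ s in (-π)..π, torusKernel r s = 0 := by
  have h := intervalIntegral.hasSum_integral_of_dominated_convergence (μ := volume)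
    (a := -π) (b := π) (f := torusKernel r)
    (F := fun (n : ℕ) s => (1 / π) * (Real.cos (((n : ℝ) + 1) * s) / ((n : ℝ) + 1) ^ r))
    (fun n _ => (1 / π) * (1 / ((n : ℝ) + 1) ^ r))
    (fun n => (by fun_prop : Continuous _).aestronglyMeasurable) ?_ ?_ ?_ ?_
  · refine h.unique ?_
    convert hasSum_zero with n
    rw [intervalIntegral.integral_const_mul, intervalIntegral.integral_div,
      intervalIntegral.integral_comp_mul_left (fun x => Real.cos x) (by positivity), integral_cos]
    have h1 : Real.sin (((n : ℝ) + 1) * π) = 0 := by exact_mod_cast Real.sin_nat_mul_pi (n + 1)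
    have h2 : Real.sin (((n : ℝ) + 1) * -π) = 0 := by rw [mul_neg, Real.sin_neg, h1, neg_zero]
    rw [h1, h2]; simp
  · refine fun n => Eventually.of_forall fun s _ => ?_
    exact norm_torusKernel_term_le n s
  · exact Eventually.of_forall fun s _ => (summable_one_div_add_one_rpow hr).mul_left _
  · exact intervalIntegrable_const
  · exact Eventually.of_forall fun s _ => hasSum_torusKernel hr s

theorem one_sub_cexp_mem_slitPlane {s : ℝ} (hs : Real.cos s ≠ 1) :
    1 - Complex.exp (s * Complex.I) ∈ Complex.slitPlane := by
  left
  rw [Complex.sub_re, Complex.one_re, Complex.exp_ofReal_mul_I_re]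
  linarith [lt_of_le_of_ne (Real.cos_le_one s) hs]

theorem contDiffAt_torusKernel {r : ℝ} (hr : 1 < r) {s : ℝ} (hs : Real.cos s ≠ 1)
    {n : WithTop ℕ∞} : ContDiffAt ℝ n (torusKernel r) s := by
  have h1 := (contDiffAt_boseIntegral hr (one_sub_cexp_mem_slitPlane hs) (n := n)).restrict_scalars ℝ
  have h2 : ContDiffAt ℝ n (fun s : ℝ => Complex.exp (s * Complex.I)) s :=
    ((Complex.ofRealCLM.contDiff.mul contDiff_const).cexp).contDiffAt
  have h3 := ContDiffAt.comp s h1 h2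
  exact contDiffAt_const.mul (Complex.reCLM.contDiff.contDiffAt.comp s h3)

/-! ### Poisson-kernel form and two-sided bounds for symmetric differences of the kernel. -/

theorem re_boseIntegrand (r s : ℝ) {t : ℝ} (ht : 0 < t) :
    (boseIntegrand r (Complex.exp (s * Complex.I)) t).re =
      t ^ (r - 1) * (Real.sinh t / (2 * (Real.cosh t - Real.cos s)) - 1 / 2) := by
  have hC : 1 < Real.cosh t := Real.one_lt_cosh.2 ht.ne'
  have hc := Real.cos_le_one s
  rw [boseIntegrand, Complex.re_ofReal_mul, Complex.div_re, Complex.normSq_apply]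
  simp only [Complex.sub_re, Complex.sub_im, Complex.ofReal_re, Complex.ofReal_im,
    Complex.exp_ofReal_mul_I_re, Complex.exp_ofReal_mul_I_im]
  have hE : Real.exp t * Real.exp (-t) = 1 := by rw [← Real.exp_add]; simp
  have h1 : Real.cosh t - Real.cos s =
      ((Real.exp t - Real.cos s) * (Real.exp t - Real.cos s) +
        (0 - Real.sin s) * (0 - Real.sin s)) * Real.exp (-t) / 2 := by
    rw [Real.cosh_eq]
    linear_combination (-(1 / 2) * Real.exp t + Real.cos s) * hE
      - Real.exp (-t) / 2 * Real.sin_sq_add_cos_sq s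
  set N := (Real.exp t - Real.cos s) * (Real.exp t - Real.cos s) +
        (0 - Real.sin s) * (0 - Real.sin s) with hN
  have hNpos : N ≠ 0 := by
    intro h0; rw [h0] at h1; simp at h1; linarith
  have he := Real.exp_pos (-t)
  rw [h1, Real.sinh_eq]
  congr 1
  field_simp
  rw [hN]
  linear_combination (Real.exp t) * hE - Real.exp (-t) * Real.sin_sq_add_cos_sq s

theorem integrableOn_re_boseIntegrand {r : ℝ} (hr : 1 < r) (s : ℝ) :
    IntegrableOn (fun t => t ^ (r - 1) *
      (Real.sinh t / (2 * (Real.cosh t - Real.cos s)) - 1 / 2)) (Ioi 0) :=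
  Integrable.congr (integrableOn_boseIntegrand hr (Complex.norm_exp_ofReal_mul_I s).le).re
    ((ae_restrict_iff' measurableSet_Ioi).2 (Eventually.of_forall fun _ ht =>
      re_boseIntegrand r s ht))

/-- The bracket is half of (Poisson kernel of radius e^{-t}, minus 1), so the singular kernel
becomes a positive mixture of explicit ones and its differences can be bounded under the integral.
-/
theorem torusKernel_eq_integral {r : ℝ} (hr : 1 < r) (s : ℝ) :
    torusKernel r s = (1 / (π * Real.Gamma r)) * ∫ t in Ioi (0 : ℝ), t ^ (r - 1) *
      (Real.sinh t / (2 * (Real.cosh t - Real.cos s)) - 1 / 2) := by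
  rw [torusKernel, boseIntegral]
  congr 1
  have h := integral_re (integrableOn_boseIntegrand hr
    (Complex.norm_exp_ofReal_mul_I s).le)
  refine (Eq.symm h).trans ?_
  exact setIntegral_congr_fun measurableSet_Ioi fun t ht => re_boseIntegrand r s ht

theorem torusKernel_sub {r : ℝ} (hr : 1 < r) {y h : ℝ} :
    IntegrableOn (fun t => t ^ (r - 1) * (Real.sinh t * Real.sin y * Real.sin h /
      ((Real.cosh t - Real.cos (y - h)) * (Real.cosh t - Real.cos (y + h))))) (Ioi 0) ∧
    torusKernel r (y - h) - torusKernel r (y + h) = (1 / (π * Real.Gamma r)) *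
      ∫ t in Ioi (0 : ℝ), t ^ (r - 1) * (Real.sinh t * Real.sin y * Real.sin h /
        ((Real.cosh t - Real.cos (y - h)) * (Real.cosh t - Real.cos (y + h)))) := by
  have e : EqOn (fun t => t ^ (r - 1) *
        (Real.sinh t / (2 * (Real.cosh t - Real.cos (y - h))) - 1 / 2) - t ^ (r - 1) *
        (Real.sinh t / (2 * (Real.cosh t - Real.cos (y + h))) - 1 / 2))
      (fun t => t ^ (r - 1) * (Real.sinh t * Real.sin y * Real.sin h /
      ((Real.cosh t - Real.cos (y - h)) * (Real.cosh t - Real.cos (y + h))))) (Ioi 0) := by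
    intro t ht
    have hC : 1 < Real.cosh t := Real.one_lt_cosh.2 (ne_of_gt ht)
    have h1 : Real.cosh t - Real.cos (y - h) ≠ 0 := by linarith [Real.cos_le_one (y - h)]
    have h2 : Real.cosh t - Real.cos (y + h) ≠ 0 := by linarith [Real.cos_le_one (y + h)]
    have h3 : Real.sin y * Real.sin h = (Real.cos (y - h) - Real.cos (y + h)) / 2 := by
      rw [Real.cos_sub, Real.cos_add]; ring
    simp only
    rw [mul_assoc (Real.sinh t), h3]
    field_simp
    ring
  have hi1 := integrableOn_re_boseIntegrand hr (y - h)
  have hi2 := integrableOn_re_boseIntegrand hr (y + h)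
  refine ⟨(hi1.sub hi2).congr_fun e measurableSet_Ioi, ?_⟩
  rw [torusKernel_eq_integral hr, torusKernel_eq_integral hr, ← mul_sub, ← integral_sub hi1 hi2]
  congr 1
  exact setIntegral_congr_fun measurableSet_Ioi e

/-- In the integral for the difference, both denominators are at most cosh t + 1, and what remains
factors as sin y sin h times a positive integral independent of y and h. -/
theorem exists_mul_sin_mul_sin_le_torusKernel_sub {r : ℝ} (hr : 1 < r) :
    ∃ c > 0, ∀ y ∈ Icc 0 π, ∀ h ∈ Icc 0 π, c * (Real.sin y * Real.sin h) ≤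
      torusKernel r (y - h) - torusKernel r (y + h) := by
  set f : ℝ → ℝ := fun t => t ^ (r - 1) * (Real.sinh t / (Real.cosh t + 1) ^ 2) with hf
  have hG : 0 < 1 / (π * Real.Gamma r) := by
    have := Real.Gamma_pos_of_pos (by linarith : 0 < r)
    positivity
  have hfpos : ∀ t ∈ Ioi (0 : ℝ), 0 < f t := fun t ht => by
    have h1 : 0 < Real.sinh t := Real.sinh_pos_iff.2 ht
    have h2 := Real.cosh_pos t
    have h3 : 0 < t ^ (r - 1) := Real.rpow_pos_of_pos ht _
    positivity
  have hint : IntegrableOn f (Ioi 0) := by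
    -- At y = h = π/2 the integrand of `torusKernel_sub` has denominator (cosh t - 1)(cosh t + 1),
    -- so it dominates f.
    refine Integrable.mono' (torusKernel_sub hr (y := π / 2) (h := π / 2)).1
      (by apply Measurable.aestronglyMeasurable; fun_prop) ?_
    refine (ae_restrict_iff' measurableSet_Ioi).2 (Eventually.of_forall fun t ht => ?_)
    rw [Real.norm_of_nonneg (hfpos t ht).le]
    have hC : 1 < Real.cosh t := Real.one_lt_cosh.2 (ne_of_gt ht)
    have h1 : 0 < Real.sinh t := Real.sinh_pos_iff.2 ht
    have h3 : 0 < t ^ (r - 1) := Real.rpow_pos_of_pos ht _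
    simp only [hf, sub_self, Real.cos_zero, add_halves, Real.cos_pi, Real.sin_pi_div_two, mul_one]
    gcongr
    · nlinarith
    · nlinarith
  refine ⟨1 / (π * Real.Gamma r) * ∫ t in Ioi (0 : ℝ), f t, mul_pos hG ?_, fun y hy h hh => ?_⟩
  · rw [setIntegral_pos_iff_support_of_nonneg_ae
      ((ae_restrict_iff' measurableSet_Ioi).2 (Eventually.of_forall fun t ht => (hfpos t ht).le))
      hint]
    have : Function.support f ∩ Ioi 0 = Ioi 0 :=
      inter_eq_right.2 fun t ht => (hfpos t ht).ne'
    rw [this]; simp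
  · obtain ⟨h1, h2⟩ := torusKernel_sub hr (y := y) (h := h)
    rw [h2, mul_assoc]
    refine mul_le_mul_of_nonneg_left ?_ hG.le
    rw [← integral_mul_const]
    refine setIntegral_mono_on (hint.mul_const _) h1 measurableSet_Ioi fun t ht => ?_
    have hC : 1 < Real.cosh t := Real.one_lt_cosh.2 (ne_of_gt ht)
    have hs : 0 < Real.sinh t := Real.sinh_pos_iff.2 ht
    have h3 : 0 < t ^ (r - 1) := Real.rpow_pos_of_pos ht _
    have hsy := Real.sin_nonneg_of_mem_Icc hy
    have hsh := Real.sin_nonneg_of_mem_Icc hh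
    have a1 := Real.cos_le_one (y - h)
    have a2 := Real.cos_le_one (y + h)
    have a3 := Real.neg_one_le_cos (y - h)
    have a4 := Real.neg_one_le_cos (y + h)
    have e : f t * (Real.sin y * Real.sin h) =
        t ^ (r - 1) * (Real.sinh t * Real.sin y * Real.sin h / (Real.cosh t + 1) ^ 2) := by
      simp only [hf]; ring
    rw [e]
    gcongr
    · apply mul_pos <;> linarith
    · rw [sq]
      gcongr <;> linarith

/-- With v = t/2 and p = (y+h)/2 the right side is 6(sinh² v + sin² p). On the left, sin y ≤ 2 sin p
and cosh v ≤ 1 + sinh v, and the product sinh v sin p is absorbed by squares. It serves to cancel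
the factor cosh t - cos(y+h). -/
theorem sinh_mul_sin_le {t y h : ℝ} (ht : 0 ≤ t) (hy : y ∈ Icc 0 π) (hh : h ∈ Icc 0 π) :
    Real.sinh t * Real.sin y ≤ 3 * (Real.cosh t - Real.cos (y + h)) := by
  obtain ⟨p, hp⟩ : ∃ p, p = (y + h) / 2 := ⟨_, rfl⟩
  obtain ⟨q, hq⟩ : ∃ q, q = (y - h) / 2 := ⟨_, rfl⟩
  obtain ⟨v, hv⟩ : ∃ v, v = t / 2 := ⟨_, rfl⟩
  have hsy := Real.sin_nonneg_of_mem_Icc hy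
  have hsh := Real.sin_nonneg_of_mem_Icc hh
  have hp0 : 0 ≤ Real.sin p := Real.sin_nonneg_of_nonneg_of_le_pi
    (by linarith [hy.1, hh.1]) (by linarith [hy.2, hh.2])
  have e1 : Real.sin y * Real.sin h = Real.sin p ^ 2 - Real.sin q ^ 2 := by
    rw [show y = p + q by rw [hp, hq]; ring, show h = p - q by rw [hp, hq]; ring,
      Real.sin_add, Real.sin_sub]
    linear_combination Real.sin p ^ 2 * Real.sin_sq_add_cos_sq q
      - Real.sin q ^ 2 * Real.sin_sq_add_cos_sq p
  have hq1 : |Real.sin q| ≤ Real.sin p := abs_le_of_sq_le_sq (by nlinarith [mul_nonneg hsy hsh]) hp0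
  have hsy2 : Real.sin y ≤ 2 * Real.sin p := by
    rw [show y = p + q by rw [hp, hq]; ring, Real.sin_add]
    have h1 : Real.sin p * Real.cos q ≤ Real.sin p :=
      mul_le_of_le_one_right hp0 (Real.cos_le_one q)
    have h2 : Real.cos p * Real.sin q ≤ |Real.sin q| := by
      refine (le_abs_self _).trans ?_
      rw [abs_mul]
      exact mul_le_of_le_one_left (abs_nonneg _) (Real.abs_cos_le_one p)
    linarith
  have hs0 : 0 ≤ Real.sinh v := Real.sinh_nonneg_iff.2 (by linarith)
  have hc1 : Real.cosh v ≤ 1 + Real.sinh v := by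
    have h1 := Real.cosh_sub_sinh v
    have h2 : Real.exp (-v) ≤ 1 := Real.exp_le_one_iff.2 (by linarith)
    linarith
  rw [show y + h = 2 * p by rw [hp]; ring, Real.cos_two_mul, show t = 2 * v by rw [hv]; ring,
    Real.cosh_two_mul, Real.sinh_two_mul, Real.cosh_sq]
  have hsc := Real.sin_sq_add_cos_sq p
  have hcv := Real.cosh_pos v
  calc 2 * Real.sinh v * Real.cosh v * Real.sin y
      ≤ 2 * Real.sinh v * Real.cosh v * (2 * Real.sin p) := by gcongr
    _ = 4 * (Real.sinh v * Real.sin p) * Real.cosh v := by ring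
    _ ≤ 4 * (Real.sinh v * Real.sin p) * (1 + Real.sinh v) := by gcongr
    _ ≤ _ := by
      have h5 : Real.sinh v * Real.sin p * Real.sinh v ≤ Real.sinh v * 1 * Real.sinh v := by
        gcongr; exact Real.sin_le_one p
      nlinarith [sq_nonneg (Real.sinh v - Real.sin p)]

theorem sq_mul_exp_le_cosh_sub_one {t : ℝ} (ht : 0 ≤ t) :
    t ^ 2 / 8 * Real.exp (t / 2) ≤ Real.cosh t - 1 := by
  have h1 : t / 4 ≤ Real.sinh (t / 4) := Real.self_le_sinh_iff.2 (by positivity)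
  have h2 : Real.exp (t / 4) / 2 ≤ Real.cosh (t / 4) := by
    rw [Real.cosh_eq]; linarith [Real.exp_pos (-(t / 4))]
  have h3 : t / 4 * Real.exp (t / 4) ≤ Real.sinh (t / 2) := by
    rw [show t / 2 = 2 * (t / 4) by ring, Real.sinh_two_mul]
    have := mul_le_mul h1 h2 (by positivity) (by linarith)
    linarith
  have h4 : Real.cosh t - 1 = 2 * Real.sinh (t / 2) ^ 2 := by
    conv_lhs => rw [show t = 2 * (t / 2) by ring, Real.cosh_two_mul, Real.cosh_sq]
    ring
  have h5 : Real.exp (t / 2) = Real.exp (t / 4) ^ 2 := by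
    rw [← Real.exp_nat_mul]; push_cast; ring_nf
  rw [h4, h5]
  have := pow_le_pow_left₀ (by positivity) h3 2
  nlinarith

theorem rpow_mul_rpow_le_add {a b θ : ℝ} (ha : 0 ≤ a) (hb : 0 ≤ b) (h0 : 0 ≤ θ) (h1 : θ ≤ 1) :
    a ^ θ * b ^ (1 - θ) ≤ a + b := by
  rcases (add_nonneg ha hb).eq_or_lt with h | h
  · have ha0 : a = 0 := by linarith
    have hb0 : b = 0 := by linarith
    subst ha0 hb0
    rcases eq_or_ne θ 0 with h | h
    · subst h; simp
    · rw [Real.zero_rpow h]; simp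
  · calc a ^ θ * b ^ (1 - θ) ≤ (a + b) ^ θ * (a + b) ^ (1 - θ) := by
          gcongr <;> linarith
      _ = a + b := by rw [← Real.rpow_add h]; simp

/-- One denominator cancels against sinh t sin y, and sin h ≤ h supplies the factor h. The other is
(cosh t - 1) + (1 - cos(y-h)), bounded below by a weighted geometric mean of its two terms, which
separates t from |y-h|. -/
theorem exists_torusKernel_sub_le {r β : ℝ} (hr : 1 < r) (hβ0 : 0 < β) (hβ1 : β < 1)
    (hβr : 2 - r < β) :
    ∃ c > 0, ∀ y ∈ Icc 0 π, ∀ h ∈ Icc 0 π, y ≠ h →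
      torusKernel r (y - h) - torusKernel r (y + h) ≤ c * (h * |y - h| ^ (-β)) := by
  have hG : 0 < 1 / (π * Real.Gamma r) := by
    have := Real.Gamma_pos_of_pos (by linarith : 0 < r)
    positivity
  -- The weight is chosen so that |y-h|^{2(1-θ)} = |y-h|^β; the remaining integral in t converges at
  -- 0 because r - 2θ > 0, that is, β > 2 - r.
  set θ := 1 - β / 2 with hθ
  have hθ0 : 0 < θ := by linarith
  set f : ℝ → ℝ := fun t => t ^ (r - 1 - 2 * θ) * Real.exp (-(θ / 2) * t) with hf
  have hint : IntegrableOn f (Ioi 0) :=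
    integrableOn_rpow_mul_exp_neg_mul (by linarith) (by linarith)
  have hfnn : 0 ≤ ∫ t in Ioi (0 : ℝ), f t :=
    setIntegral_nonneg measurableSet_Ioi fun t ht =>
      mul_nonneg (Real.rpow_nonneg (le_of_lt ht) _) (Real.exp_pos _).le
  set κ : ℝ := 3 * ((1 / 8) ^ θ * (2 / π ^ 2) ^ (1 - θ))⁻¹ with hκ
  have hκ0 : 0 < κ := by positivity
  -- The added 1 makes the constant positive from mere nonnegativity of ∫ f.
  refine ⟨1 / (π * Real.Gamma r) * (κ * (∫ t in Ioi (0 : ℝ), f t)) + 1, by positivity,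
    fun y hy h hh hne => ?_⟩
  obtain ⟨h1, h2⟩ := torusKernel_sub hr (y := y) (h := h)
  have hX : 0 ≤ h * |y - h| ^ (-β) := mul_nonneg hh.1 (Real.rpow_nonneg (abs_nonneg _) _)
  suffices hmain : ∫ t in Ioi (0 : ℝ), t ^ (r - 1) * (Real.sinh t * Real.sin y * Real.sin h /
        ((Real.cosh t - Real.cos (y - h)) * (Real.cosh t - Real.cos (y + h)))) ≤
      ∫ t in Ioi (0 : ℝ), f t * (κ * (h * |y - h| ^ (-β))) by
    rw [h2]
    rw [integral_mul_const] at hmain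
    have := mul_le_mul_of_nonneg_left hmain hG.le
    nlinarith
  refine setIntegral_mono_on h1 (hint.mul_const _) measurableSet_Ioi fun t ht => ?_
  have ht : 0 < t := ht
  have hC : 1 < Real.cosh t := Real.one_lt_cosh.2 ht.ne'
  have a1 := Real.cos_le_one (y - h)
  have a2 := Real.cos_le_one (y + h)
  have d1 : 0 < Real.cosh t - Real.cos (y - h) := by linarith
  have d2 : 0 < Real.cosh t - Real.cos (y + h) := by linarith
  have hsh := Real.sin_nonneg_of_mem_Icc hh
  have hd : 0 < |y - h| := abs_pos.2 (sub_ne_zero.2 hne)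
  have b1 : Real.sinh t * Real.sin y * Real.sin h /
        ((Real.cosh t - Real.cos (y - h)) * (Real.cosh t - Real.cos (y + h))) ≤
        3 * h / (Real.cosh t - Real.cos (y - h)) := by
    rw [div_le_div_iff₀ (mul_pos d1 d2) d1]
    have h3 := sinh_mul_sin_le ht.le hy hh
    have h4 : Real.sin h ≤ h := Real.sin_le hh.1
    have h5 : Real.sinh t * Real.sin y * Real.sin h ≤
        3 * (Real.cosh t - Real.cos (y + h)) * h := by
      refine (mul_le_mul_of_nonneg_right h3 hsh).trans ?_
      gcongr
    calc _ ≤ 3 * (Real.cosh t - Real.cos (y + h)) * h * (Real.cosh t - Real.cos (y - h)) := by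
          gcongr
      _ = _ := by ring
  have b2 : (1 / 8) ^ θ * (2 / π ^ 2) ^ (1 - θ) *
      (t ^ (2 * θ) * Real.exp (θ / 2 * t) * |y - h| ^ β) ≤
      Real.cosh t - Real.cos (y - h) := by
    have c1 := sq_mul_exp_le_cosh_sub_one ht.le
    have c2 : 2 / π ^ 2 * |y - h| ^ 2 ≤ 1 - Real.cos (y - h) := by
      have := Real.cos_le_one_sub_mul_cos_sq (x := y - h)
        (abs_le.2 ⟨by linarith [hy.1, hh.2], by linarith [hy.2, hh.1]⟩)
      rw [sq_abs]; linarith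
    have c3 := rpow_mul_rpow_le_add (a := t ^ 2 / 8 * Real.exp (t / 2))
      (b := 2 / π ^ 2 * |y - h| ^ 2) (by positivity) (by positivity) hθ0.le
      (by linarith : θ ≤ 1)
    have e1 : (t ^ 2 / 8 * Real.exp (t / 2)) ^ θ =
        (1 / 8) ^ θ * (t ^ (2 * θ) * Real.exp (θ / 2 * t)) := by
      rw [show t ^ 2 / 8 * Real.exp (t / 2) = (1 / 8) * (t ^ 2 * Real.exp (t / 2)) by ring,
        Real.mul_rpow (by positivity) (by positivity), Real.mul_rpow (by positivity) (by positivity),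
        ← Real.exp_mul, ← Real.rpow_natCast, ← Real.rpow_mul ht.le]
      push_cast; ring_nf
    have e2 : (2 / π ^ 2 * |y - h| ^ 2) ^ (1 - θ) = (2 / π ^ 2) ^ (1 - θ) * |y - h| ^ β := by
      rw [Real.mul_rpow (by positivity) (by positivity), ← Real.rpow_natCast |y - h| 2,
        ← Real.rpow_mul hd.le]
      congr 2
      rw [hθ]; push_cast; ring
    rw [e1, e2] at c3
    calc _ = _ := by ring
      _ ≤ _ := c3
      _ ≤ _ := by linarith
  have hh0 := hh.1
  calc _ ≤ t ^ (r - 1) * (3 * h / ((1 / 8) ^ θ * (2 / π ^ 2) ^ (1 - θ) *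
      (t ^ (2 * θ) * Real.exp (θ / 2 * t) * |y - h| ^ β))) := by
        refine mul_le_mul_of_nonneg_left (b1.trans ?_) (by positivity)
        have : 0 < |y - h| ^ β := by positivity
        gcongr
    _ = _ := by
      simp only [hf, hκ]
      rw [Real.rpow_sub ht (r - 1) (2 * θ), Real.rpow_neg hd.le, show -(θ / 2) * t = -(θ / 2 * t) by ring,
        Real.exp_neg]
      field_simp

/-! ### `L_r` as a convolution, and its symmetric differences. -/

/-- Convolution with `torusKernel r` over a period. -/
noncomputable def torusConv (r : ℝ) (u : ℝ → ℝ) (x : ℝ) : ℝ :=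
  ∫ y in (-π)..π, torusKernel r (x - y) * u y

theorem hasSum_of_eq {ι : Type*} {f g : ι → ℂ} {a : ℂ} (h : HasSum f a) (e : ∀ i, g i = f i) :
    HasSum g a := by
  rwa [funext e]

theorem homSymbol_add_one (r : ℝ) (n : ℕ) : homSymbol r ((n : ℤ) + 1) = 1 / ((n : ℝ) + 1) ^ r := by
  rw [homSymbol, if_neg (by positivity), Real.rpow_neg (abs_nonneg _)]
  push_cast
  rw [abs_of_pos (by positivity), one_div]

theorem homSymbol_neg (r : ℝ) (k : ℤ) : homSymbol r (-k) = homSymbol r k := by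
  simp [homSymbol]

theorem hasSum_homSymbol_pos {r : ℝ} (hr : 1 < r) (s : ℝ) :
    HasSum (fun n : ℕ => (homSymbol r ((n : ℤ) + 1) : ℂ) *
      Complex.exp (Complex.I * (((n : ℤ) + 1 : ℤ) : ℂ) * s))
      (boseIntegral r (Complex.exp (s * Complex.I)) / (Real.Gamma r : ℝ)) := by
  refine hasSum_of_eq (hasSum_boseIntegral hr (Complex.norm_exp_ofReal_mul_I s).le) fun n => ?_
  rw [homSymbol_add_one, ← Complex.exp_nat_mul]
  push_cast
  rw [show ((n : ℂ) + 1) * ((s : ℂ) * Complex.I) = Complex.I * ((n : ℂ) + 1) * s by ring]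
  ring

theorem hasSum_homSymbol_mul_exp {r : ℝ} (hr : 1 < r) (s : ℝ) :
    HasSum (fun k : ℤ => (homSymbol r k : ℂ) * Complex.exp (Complex.I * k * s))
      (((2 * π * torusKernel r s : ℝ)) : ℂ) := by
  have h4 : HasSum (fun n : ℕ => (homSymbol r (-((n : ℤ) + 1)) : ℂ) *
      Complex.exp (Complex.I * ((-((n : ℤ) + 1) : ℤ) : ℂ) * s))
      (boseIntegral r (Complex.exp ((-s : ℝ) * Complex.I)) / (Real.Gamma r : ℝ)) := by
    refine hasSum_of_eq (hasSum_homSymbol_pos hr (-s)) fun n => ?_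
    rw [homSymbol_neg]
    push_cast
    ring_nf
  have h := HasSum.of_add_one_of_neg_add_one
    (f := fun k : ℤ => (homSymbol r k : ℂ) * Complex.exp (Complex.I * k * s))
    (hasSum_homSymbol_pos hr s) h4
  have hG : Real.Gamma r ≠ 0 := (Real.Gamma_pos_of_pos (by linarith)).ne'
  have h0 : homSymbol r 0 = 0 := by simp [homSymbol]
  rw [boseIntegral_exp_neg, h0, Complex.ofReal_zero, zero_mul, add_zero, ← add_div,
    Complex.add_conj, ← Complex.ofReal_div] at h
  have e : 2 * π * torusKernel r s =
      2 * (boseIntegral r (Complex.exp (s * Complex.I))).re / Real.Gamma r := by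
    rw [torusKernel]; field_simp
  rw [e]
  exact h

theorem torusCoeff_eq (f : ℝ → ℝ) (k : ℤ) :
    torusCoeff f k = (1 / (2 * π) : ℂ) * ∫ y in (-π)..π, Complex.exp (-(Complex.I * k * y)) * f y := by
  rw [torusCoeff, fourierCoeffOn_eq_integral, Complex.real_smul]
  congr 1
  · push_cast; ring
  · congr 1
    funext y
    rw [fourier_coe_apply, smul_eq_mul]
    congr 2
    push_cast
    have : (π : ℂ) ≠ 0 := Complex.ofReal_ne_zero.2 Real.pi_ne_zero
    field_simp
    ring

theorem summable_norm_homSymbol {r : ℝ} (hr : 1 < r) : Summable fun k : ℤ => ‖homSymbol r k‖ := by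
  have h := (hasSum_homSymbol_mul_exp hr 0).summable.norm
  simpa using h

/-- Absolute summability of the symbol and boundedness of f allow the kernel series to be integrated
term by term. -/
theorem Lmult_eq_torusConv {r : ℝ} (hr : 1 < r) {f : ℝ → ℝ} (hf : Measurable f) {M : ℝ}
    (hM : ∀ x, |f x| ≤ M) (x : ℝ) : Lmult r f x = (torusConv r f x : ℝ) := by
  have h := intervalIntegral.hasSum_integral_of_dominated_convergence (μ := volume)
    (a := -π) (b := π) (f := fun y => ((torusKernel r (x - y) * f y : ℝ) : ℂ))
    (F := fun (k : ℤ) y => (1 / (2 * π) : ℂ) * ((homSymbol r k : ℂ) *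
      Complex.exp (Complex.I * k * (x - y : ℝ))) * f y)
    (fun k _ => 1 / (2 * π) * ‖homSymbol r k‖ * M)
    (fun k => by apply Measurable.aestronglyMeasurable; fun_prop) ?_ ?_ ?_ ?_
  · rw [intervalIntegral.integral_ofReal] at h
    rw [torusConv, ← h.tsum_eq, Lmult]
    congr 1
    funext k
    rw [torusCoeff_eq, ← intervalIntegral.integral_const_mul, ← intervalIntegral.integral_const_mul,
      ← intervalIntegral.integral_mul_const]
    congr 1
    funext y
    rw [show Complex.I * k * ((x - y : ℝ) : ℂ) = -(Complex.I * k * y) + Complex.I * k * x by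
      push_cast; ring, Complex.exp_add]
    ring
  · refine fun k => Eventually.of_forall fun y _ => ?_
    have e : ‖Complex.exp (Complex.I * k * ((x - y : ℝ) : ℂ))‖ = 1 := by
      rw [show Complex.I * k * ((x - y : ℝ) : ℂ) = ((k * (x - y) : ℝ) : ℂ) * Complex.I by
        push_cast; ring]
      exact Complex.norm_exp_ofReal_mul_I _
    have e2 : ‖(1 / (2 * π) : ℂ)‖ = 1 / (2 * π) := by
      rw [show (1 / (2 * π) : ℂ) = ((1 / (2 * π) : ℝ) : ℂ) by push_cast; rfl, Complex.norm_real,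
        Real.norm_of_nonneg (by positivity)]
    rw [norm_mul, norm_mul, norm_mul, e, e2, Complex.norm_real, Complex.norm_real, mul_one]
    gcongr
    exact hM y
  · exact Eventually.of_forall fun y _ => ((summable_norm_homSymbol hr).mul_left _).mul_right _
  · exact intervalIntegrable_const
  · refine Eventually.of_forall fun y _ => ?_
    have h := ((hasSum_homSymbol_mul_exp hr (x - y)).mul_left (1 / (2 * π) : ℂ)).mul_right (f y : ℂ)
    have e : ((torusKernel r (x - y) * f y : ℝ) : ℂ) =
        (1 / (2 * π) : ℂ) * ((2 * π * torusKernel r (x - y) : ℝ) : ℂ) * (f y : ℂ) := by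
      push_cast
      have : (π : ℂ) ≠ 0 := Complex.ofReal_ne_zero.2 Real.pi_ne_zero
      field_simp
    rw [e]
    exact h

theorem exists_abs_torusKernel_le {r : ℝ} (hr : 1 < r) : ∃ B, ∀ s, |torusKernel r s| ≤ B := by
  obtain ⟨B, hB⟩ := isCompact_Icc.exists_bound_of_continuousOn (s := Icc 0 (2 * π))
    (continuous_torusKernel hr).continuousOn
  refine ⟨B, fun s => ?_⟩
  obtain ⟨y, hy, hs⟩ := (periodic_torusKernel r).exists_mem_Ico₀ Real.two_pi_pos s
  rw [hs]
  exact hB y (Ico_subset_Icc_self hy)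

theorem continuous_torusConv {r : ℝ} (hr : 1 < r) {f : ℝ → ℝ} (hf : Measurable f) {M : ℝ}
    (hM : ∀ x, |f x| ≤ M) : Continuous (torusConv r f) := by
  obtain ⟨B, hB⟩ := exists_abs_torusKernel_le hr
  have hK := continuous_torusKernel hr
  refine intervalIntegral.continuous_of_dominated_interval (bound := fun _ => B * M)
    (fun x => ?_) (fun x => Eventually.of_forall fun y _ => ?_) intervalIntegrable_const
    (Eventually.of_forall fun y _ => by fun_prop)
  · have := hK.measurable
    apply Measurable.aestronglyMeasurable; fun_prop
  · rw [norm_mul]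
    exact mul_le_mul (hB _) (hM _) (abs_nonneg _) ((abs_nonneg _).trans (hB 0))

theorem torusConv_eq_window {r : ℝ} {u : ℝ → ℝ} (hp : Function.Periodic u (2 * π)) (x a : ℝ) :
    torusConv r u x = ∫ y in a..(a + 2 * π), torusKernel r (x - y) * u y := by
  have h : Function.Periodic (fun y => torusKernel r (x - y) * u y) (2 * π) := by
    intro y
    simp only
    rw [hp y, ← sub_sub, (periodic_torusKernel r).sub_eq]
  have := h.intervalIntegral_add_eq (-π) a
  rw [torusConv, ← this]
  congr 1; ring

theorem torusConv_add {r : ℝ} {u : ℝ → ℝ} (hp : Function.Periodic u (2 * π)) (x h : ℝ) :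
    torusConv r u (x + h) = ∫ y in (-π)..π, torusKernel r (x - y) * u (y + h) := by
  have e := intervalIntegral.integral_comp_add_right (a := -π) (b := π)
    (fun y => torusKernel r (x + h - y) * u y) h
  rw [torusConv_eq_window hp (x + h) (-π + h), show -π + h + 2 * π = π + h by ring, ← e]
  congr 1
  funext y
  congr 2; ring

theorem integral_eq_of_even {f : ℝ → ℝ} (hf : Continuous f) (a : ℝ) :
    ∫ y in (-a)..a, f y = ∫ y in (0 : ℝ)..a, (f y + f (-y)) := by
  have h1 : ∫ y in (-a)..0, f y = ∫ y in (0 : ℝ)..a, f (-y) := by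
    rw [intervalIntegral.integral_comp_neg]; simp
  rw [intervalIntegral.integral_add (hf.intervalIntegrable _ _)
    ((by fun_prop : Continuous fun y => f (-y)).intervalIntegrable _ _), ← h1, add_comm,
    intervalIntegral.integral_add_adjacent_intervals (hf.intervalIntegrable _ _)
    (hf.intervalIntegrable _ _)]

/-- Move the shift from the kernel to u, then fold [-π, 0] onto [0, π]: evenness of K and u turns
the folded integrand into a product of two symmetric differences. -/
theorem torusConv_add_sub_torusConv_sub {r : ℝ} (hr : 1 < r) {u : ℝ → ℝ} (hc : Continuous u)
    (hp : Function.Periodic u (2 * π)) (he : Function.Even u) (m h : ℝ) :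
    torusConv r u (m + h) - torusConv r u (m - h) =
      ∫ y in (0 : ℝ)..π, (torusKernel r (y - m) - torusKernel r (y + m)) * (u (y + h) - u (y - h)) := by
  have hK := continuous_torusKernel hr
  rw [sub_eq_add_neg m h, torusConv_add hp, torusConv_add hp, ← intervalIntegral.integral_sub
    (by apply Continuous.intervalIntegrable; fun_prop)
    (by apply Continuous.intervalIntegrable; fun_prop),
    integral_eq_of_even (by fun_prop)]
  congr 1
  funext y
  rw [← torusKernel_neg r (m - y), show -y + h = -(y - h) by ring, he,
    show -y + -h = -(y + h) by ring, he]
  ring_nf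

theorem torusConv_even {r : ℝ} (hr : 1 < r) {u : ℝ → ℝ} (hc : Continuous u)
    (hp : Function.Periodic u (2 * π)) (he : Function.Even u) : Function.Even (torusConv r u) := by
  intro x
  have h := torusConv_add_sub_torusConv_sub hr hc hp he 0 x
  simp only [sub_zero, add_zero, sub_self, zero_mul, intervalIntegral.integral_zero, zero_add,
    zero_sub] at h
  linarith

/-- Evenness of the convolution exchanges m and h. Here the kernel difference carries h, so the
upper kernel bound yields the factor h explicitly. -/
theorem torusConv_add_sub_torusConv_sub' {r : ℝ} (hr : 1 < r) {u : ℝ → ℝ} (hc : Continuous u)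
    (hp : Function.Periodic u (2 * π)) (he : Function.Even u) (m h : ℝ) :
    torusConv r u (m + h) - torusConv r u (m - h) =
      ∫ y in (0 : ℝ)..π, (torusKernel r (y - h) - torusKernel r (y + h)) * (u (y + m) - u (y - m)) := by
  rw [← torusConv_add_sub_torusConv_sub hr hc hp he h m, add_comm, ← neg_sub h m,
    torusConv_even hr hc hp he]

theorem integral_torusConv {r : ℝ} (hr : 1 < r) {f : ℝ → ℝ} (hf : Continuous f) :
    ∫ x in (-π)..π, torusConv r f x = 0 := by
  have hK := continuous_torusKernel hr
  have hK0 : ∀ y, ∫ x in (-π)..π, torusKernel r (x - y) = 0 := by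
    intro y
    rw [intervalIntegral.integral_comp_sub_right (fun x => torusKernel r x),
      ← integral_torusKernel hr]
    have := (periodic_torusKernel r).intervalIntegral_add_eq (-π - y) (-π)
    convert this using 2 <;> ring
  simp only [torusConv]
  have hcont : Continuous (Function.uncurry fun x y => torusKernel r (x - y) * f y) := by
    simp only [Function.uncurry_def]; fun_prop
  rw [intervalIntegral_intervalIntegral_swap
    ((hcont.continuousOn.integrableOn_compact (isCompact_uIcc.prod isCompact_uIcc)).mono_set
      (prod_mono uIoc_subset_uIcc uIoc_subset_uIcc))]
  simp_rw [intervalIntegral.integral_mul_const, hK0]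
  simp

theorem torusConv_const {r : ℝ} (hr : 1 < r) (a x : ℝ) : torusConv r (fun _ => a) x = 0 := by
  rw [torusConv, intervalIntegral.integral_mul_const,
    intervalIntegral.integral_comp_sub_left (fun y => torusKernel r y)]
  have := (periodic_torusKernel r).intervalIntegral_add_eq (x - π) (-π)
  rw [show x - π + 2 * π = x - -π by ring, show -π + 2 * π = π by ring, integral_torusKernel hr]
    at this
  rw [this, zero_mul]

/-! ### Crest profiles: folding onto a half period and a sine identity. -/

/-- The depth `u = μ - φ` below a crest at `0` of an even wave profile that is monotone on a half
period: it solves `u² = 2 (K_r * u - (K_r * u)(0))`. -/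
structure IsCrestProfile (r : ℝ) (u : ℝ → ℝ) : Prop where
  continuous : Continuous u
  periodic : Function.Periodic u (2 * π)
  even : Function.Even u
  monotoneOn : MonotoneOn u (Icc 0 π)
  zero : u 0 = 0
  pos : 0 < u π
  sq_eq : ∀ x, u x ^ 2 = 2 * (torusConv r u x - torusConv r u 0)

/-- The circle norm is the distance to 2πℤ, so statements on [0, π] transfer to the whole line. -/
theorem apply_eq_apply_norm {u : ℝ → ℝ} (hp : Function.Periodic u (2 * π)) (he : Function.Even u)
    (x : ℝ) : u x = u ‖(x : AddCircle (2 * π))‖ := by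
  rw [AddCircle.norm_eq]
  rcases abs_choice (x - round ((2 * π)⁻¹ * x) * (2 * π)) with h | h
  · rw [h, hp.sub_int_mul_eq]
  · rw [h, he, hp.sub_int_mul_eq]

theorem norm_coe_mem_Icc (x : ℝ) : ‖(x : AddCircle (2 * π))‖ ∈ Icc 0 π := by
  refine ⟨norm_nonneg _, (AddCircle.norm_le_half_period _ Real.two_pi_pos.ne').trans_eq ?_⟩
  rw [abs_of_pos Real.two_pi_pos]; ring

theorem integral_comp_add_right_of_periodic {g : ℝ → ℝ} (hg : Function.Periodic g (2 * π)) (h : ℝ) :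
    ∫ y in (-π)..π, g (y + h) = ∫ y in (-π)..π, g y := by
  rw [intervalIntegral.integral_comp_add_right]
  have := hg.intervalIntegral_add_eq (-π + h) (-π)
  convert this using 2 <;> ring

theorem integral_sin_mul_sub {u : ℝ → ℝ} (hc : Continuous u) (hp : Function.Periodic u (2 * π))
    (he : Function.Even u) (h : ℝ) :
    ∫ y in (0 : ℝ)..π, Real.sin y * (u (y + h) - u (y - h)) =
      2 * Real.sin h * -∫ y in (0 : ℝ)..π, u y * Real.cos y := by
  have e1 : ∫ y in (-π)..π, Real.sin y * (u (y + h) - u (y - h)) =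
      2 * ∫ y in (0 : ℝ)..π, Real.sin y * (u (y + h) - u (y - h)) := by
    rw [integral_eq_of_even (by fun_prop), ← intervalIntegral.integral_const_mul]
    congr 1
    funext y
    rw [show -y + h = -(y - h) by ring, he, show -y - h = -(y + h) by ring, he, Real.sin_neg]
    ring
  have e2 : ∫ y in (-π)..π, u y * Real.cos y = 2 * ∫ y in (0 : ℝ)..π, u y * Real.cos y := by
    rw [integral_eq_of_even (by fun_prop), ← intervalIntegral.integral_const_mul]
    congr 1
    funext y
    rw [he, Real.cos_neg]
    ring
  have e3 : ∀ a, ∫ y in (-π)..π, Real.sin y * u (y + a) =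
      ∫ y in (-π)..π, Real.sin (y - a) * u y := by
    intro a
    rw [← integral_comp_add_right_of_periodic (g := fun y => Real.sin (y - a) * u y) _ a]
    · simp
    · intro y
      simp only
      rw [hp y, show y + 2 * π - a = y - a + 2 * π by ring, Real.sin_add_two_pi]
  have e4 : ∫ y in (-π)..π, Real.sin y * (u (y + h) - u (y - h)) =
      -(2 * Real.sin h) * ∫ y in (-π)..π, u y * Real.cos y := by
    simp_rw [mul_sub, sub_eq_add_neg _ h]
    rw [intervalIntegral.integral_sub (by apply Continuous.intervalIntegrable; fun_prop)
      (by apply Continuous.intervalIntegrable; fun_prop), e3, e3, ← intervalIntegral.integral_sub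
      (by apply Continuous.intervalIntegrable; fun_prop)
      (by apply Continuous.intervalIntegrable; fun_prop), ← intervalIntegral.integral_const_mul]
    congr 1
    funext y
    rw [sub_neg_eq_add, Real.sin_sub, Real.sin_add]
    ring
  rw [e1, e2] at e4
  linarith

/-! ### Strict monotonicity and the linear lower bound at the crest. -/

namespace IsCrestProfile

variable {r : ℝ} {u : ℝ → ℝ}

theorem nonneg (H : IsCrestProfile r u) (x : ℝ) : 0 ≤ u x := by
  rw [apply_eq_apply_norm H.periodic H.even, ← H.zero]
  exact H.monotoneOn (left_mem_Icc.2 Real.pi_pos.le) (norm_coe_mem_Icc x) (norm_nonneg _)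

theorem le_apply_pi (H : IsCrestProfile r u) (x : ℝ) : u x ≤ u π := by
  rw [apply_eq_apply_norm H.periodic H.even]
  exact H.monotoneOn (norm_coe_mem_Icc x) (right_mem_Icc.2 Real.pi_pos.le) (norm_coe_mem_Icc x).2

/-- Fold y - h to |y-h| and, if y + h exceeds π, fold it to 2π - (y+h); both points lie in [0, π] in
the right order. -/
theorem apply_sub_le_apply_add (H : IsCrestProfile r u) {y h : ℝ} (hy : y ∈ Icc 0 π)
    (hh : h ∈ Icc 0 π) : u (y - h) ≤ u (y + h) := by
  obtain ⟨hy0, hy1⟩ := hy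
  obtain ⟨hh0, hh1⟩ := hh
  have e : u (y - h) = u |y - h| := by
    rcases abs_choice (y - h) with h | h
    · rw [h]
    · rw [h, H.even]
  have hm : |y - h| ∈ Icc 0 π :=
    ⟨abs_nonneg _, abs_le.2 ⟨by linarith, by linarith⟩⟩
  rw [e]
  rcases le_total (y + h) π with hle | hle
  · exact H.monotoneOn hm ⟨by linarith, hle⟩ (abs_le.2 ⟨by linarith, by linarith⟩)
  · have e2 : u (y + h) = u (2 * π - (y + h)) := by
      rw [← H.even, ← H.periodic]; congr 1; ring
    rw [e2]
    exact H.monotoneOn hm ⟨by linarith, by linarith⟩ (abs_le.2 ⟨by linarith, by linarith⟩)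

/-- Reflecting y ↦ π - y on the second half gives ∫_0^{π/2} (u(π-y) - u(y)) cos y dy, with
nonnegative integrand that is positive at y = 0. -/
theorem neg_integral_mul_cos_pos (H : IsCrestProfile r u) :
    0 < -∫ y in (0 : ℝ)..π, u y * Real.cos y := by
  have hc := H.continuous
  have hpi := Real.pi_pos
  have e1 : ∫ y in (π / 2)..π, u y * Real.cos y =
      ∫ y in (0 : ℝ)..(π / 2), -(u (π - y) * Real.cos y) := by
    have := intervalIntegral.integral_comp_sub_left (a := 0) (b := π / 2)
      (fun y => u y * Real.cos y) π
    rw [show π - π / 2 = π / 2 by ring, sub_zero] at this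
    rw [← this]
    congr 1
    funext y
    rw [Real.cos_pi_sub]; ring
  have e2 : -∫ y in (0 : ℝ)..π, u y * Real.cos y =
      ∫ y in (0 : ℝ)..(π / 2), (u (π - y) - u y) * Real.cos y := by
    rw [← intervalIntegral.integral_add_adjacent_intervals (b := π / 2)
      (by apply Continuous.intervalIntegrable; fun_prop)
      (by apply Continuous.intervalIntegrable; fun_prop), e1, ← intervalIntegral.integral_add
      (by apply Continuous.intervalIntegrable; fun_prop)
      (by apply Continuous.intervalIntegrable; fun_prop), ← intervalIntegral.integral_neg]
    congr 1
    funext y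
    ring
  rw [e2]
  refine intervalIntegral.integral_pos (by linarith) (by fun_prop) (fun y hy => ?_)
    ⟨0, ⟨le_rfl, by linarith⟩, ?_⟩
  · refine mul_nonneg (sub_nonneg.2 ?_)
      (Real.cos_nonneg_of_neg_pi_div_two_le_of_le (by linarith [hy.1]) hy.2)
    exact H.monotoneOn ⟨hy.1.le, by linarith [hy.2]⟩ ⟨by linarith [hy.2], by linarith [hy.1]⟩
      (by linarith [hy.2])
  · simp [H.zero, H.pos]

/-- Bounding the kernel difference below by c sin m sin y leaves the sine moment of u(y+h) - u(y-h),
which equals 2 sin h times a positive constant. -/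
theorem exists_le_torusConv_sub (H : IsCrestProfile r u) (hr : 1 < r) :
    ∃ c > 0, ∀ m ∈ Icc 0 π, ∀ h ∈ Icc 0 π,
      c * (Real.sin m * Real.sin h) ≤ torusConv r u (m + h) - torusConv r u (m - h) := by
  obtain ⟨c, hc, hK⟩ := exists_mul_sin_mul_sin_le_torusKernel_sub hr
  have hu := H.continuous
  have hKc := continuous_torusKernel hr
  refine ⟨c * (2 * -∫ y in (0 : ℝ)..π, u y * Real.cos y), by
    have := H.neg_integral_mul_cos_pos; positivity, fun m hm h hh => ?_⟩
  rw [torusConv_add_sub_torusConv_sub hr H.continuous H.periodic H.even]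
  have e := integral_sin_mul_sub H.continuous H.periodic H.even h
  calc _ = ∫ y in (0 : ℝ)..π, c * Real.sin m * (Real.sin y * (u (y + h) - u (y - h))) := by
        rw [intervalIntegral.integral_const_mul, e]; ring
    _ ≤ _ := by
        refine intervalIntegral.integral_mono_on Real.pi_pos.le
          (by apply Continuous.intervalIntegrable; fun_prop)
          (by apply Continuous.intervalIntegrable; fun_prop) fun y hy => ?_
        have h1 := mul_le_mul_of_nonneg_right (hK y hy m hm)
          (sub_nonneg.2 (H.apply_sub_le_apply_add hy hh))
        calc _ = _ := by ring
          _ ≤ _ := h1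

theorem strictMonoOn (H : IsCrestProfile r u) (hr : 1 < r) : StrictMonoOn u (Icc 0 π) := by
  obtain ⟨c, hc, hL⟩ := H.exists_le_torusConv_sub hr
  intro x hx y hy hxy
  have h1 := hL ((x + y) / 2) ⟨by linarith [hx.1, hy.1], by linarith [hx.2, hy.2]⟩
    ((y - x) / 2) ⟨by linarith, by linarith [hx.1, hy.2, Real.pi_pos]⟩
  rw [show (x + y) / 2 + (y - x) / 2 = y by ring, show (x + y) / 2 - (y - x) / 2 = x by ring] at h1
  have s1 : 0 < Real.sin ((x + y) / 2) :=
    Real.sin_pos_of_pos_of_lt_pi (by linarith [hx.1]) (by linarith [hy.2])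
  have s2 : 0 < Real.sin ((y - x) / 2) :=
    Real.sin_pos_of_pos_of_lt_pi (by linarith) (by linarith [hx.1, hy.2, Real.pi_pos])
  have h2 : 0 < c * (Real.sin ((x + y) / 2) * Real.sin ((y - x) / 2)) := by positivity
  refine lt_of_pow_lt_pow_left₀ 2 (H.nonneg y) ?_
  rw [H.sq_eq, H.sq_eq]
  linarith

theorem exists_mul_le (H : IsCrestProfile r u) (hr : 1 < r) :
    ∃ c > 0, ∀ x ∈ Icc 0 π, c * x ≤ u x := by
  obtain ⟨c, hc, hL⟩ := H.exists_le_torusConv_sub hr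
  -- Taking m = h = x/2 and using sin(x/2) ≥ x/π gives u(x)² ≥ 2c (x/π)².
  refine ⟨√(2 * c) / π, by positivity, fun x hx => ?_⟩
  have hx0 := hx.1
  have h1 := hL (x / 2) ⟨by linarith [hx.1], by linarith [hx.2, hx.1]⟩
    (x / 2) ⟨by linarith [hx.1], by linarith [hx.2, hx.1]⟩
  rw [add_halves, sub_self] at h1
  have h2 : 2 / π * (x / 2) ≤ Real.sin (x / 2) :=
    Real.mul_le_sin (by linarith) (by linarith [hx.2])
  have h3 : 2 / π * (x / 2) * (2 / π * (x / 2)) ≤ Real.sin (x / 2) * Real.sin (x / 2) := by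
    have : 0 ≤ 2 / π * (x / 2) := by positivity
    exact mul_le_mul h2 h2 this (this.trans h2)
  refine (pow_le_pow_iff_left₀ (by positivity) (H.nonneg x) two_ne_zero).1 ?_
  rw [H.sq_eq]
  have e : (√(2 * c) / π * x) ^ 2 = 2 * (c * (2 / π * (x / 2) * (2 / π * (x / 2)))) := by
    rw [mul_pow, div_pow, Real.sq_sqrt (by positivity)]
    field_simp
  rw [e]
  have h4 := mul_le_mul_of_nonneg_left h3 hc.le
  linarith

end IsCrestProfile

/-! ### The linear upper bound at the crest and the Lipschitz estimate. -/

theorem intervalIntegrable_abs_rpow_neg {β : ℝ} (hβ : β < 1) (a b : ℝ) :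
    IntervalIntegrable (fun s : ℝ => |s| ^ (-β)) volume a b := by
  have h0 : ∀ c, 0 ≤ c → IntervalIntegrable (fun s : ℝ => |s| ^ (-β)) volume 0 c := by
    intro c hc
    refine (intervalIntegral.intervalIntegrable_rpow' (a := 0) (b := c)
      (by linarith : -1 < -β)).congr fun s hs => ?_
    rw [uIoc_of_le hc] at hs
    simp only [abs_of_pos hs.1]
  have h1 : ∀ c, IntervalIntegrable (fun s : ℝ => |s| ^ (-β)) volume 0 c := by
    intro c
    rcases le_total 0 c with hc | hc
    · exact h0 c hc
    · rw [IntervalIntegrable.iff_comp_neg]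
      simpa using h0 (-c) (by linarith)
  exact (h1 a).symm.trans (h1 b)

theorem integral_abs_rpow_neg_le {β a b : ℝ} (hβ : β < 1) (ha : -π ≤ a) (hab : a ≤ b) (hb : b ≤ π) :
    ∫ s in a..b, |s| ^ (-β) ≤ ∫ s in (-π)..π, |s| ^ (-β) :=
  intervalIntegral.integral_mono_interval ha hab hb
    (Eventually.of_forall fun s => Real.rpow_nonneg (abs_nonneg s) _)
    (intervalIntegrable_abs_rpow_neg hβ _ _)

namespace IsCrestProfile

variable {r : ℝ} {u : ℝ → ℝ}

/-- The point is a bound linear in m + ε although the weight is singular. Shifting puts the two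
terms on a common interval with weights |z-(m+h)|^{-β} and |z+(m-h)|^{-β}, whose difference is
nonnegative; so u may be replaced by its majorant A(z+ε). For this affine function, shifting back
leaves a difference of 2m times an integrable weight, plus end pieces of size O(m+ε). -/
theorem integral_abs_rpow_mul_le (H : IsCrestProfile r u) {β : ℝ} (hβ0 : 0 < β) (hβ1 : β < 1)
    {A ε : ℝ} (hε : 0 ≤ ε) (hA0 : 0 ≤ A) (hA : ∀ z ∈ Icc 0 π, u z ≤ A * (z + ε)) {m h : ℝ}
    (hh : 0 ≤ h) (hhm : h ≤ m) (hm : m ≤ π / 6) :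
    ∫ y in (0 : ℝ)..π, |y - h| ^ (-β) * (u (y + m) - u (y - m)) ≤
      A * ((5 * m + ε) * ∫ s in (-π)..π, |s| ^ (-β)) + 2 * m * (u π * (π / 2) ^ (-β)) := by
  have hu := H.continuous
  have hpi := Real.pi_pos
  have hm0 : 0 ≤ m := hh.trans hhm
  set κ := ∫ s in (-π)..π, |s| ^ (-β) with hκ
  have hk : ∀ d a b : ℝ, IntervalIntegrable (fun s : ℝ => |s - d| ^ (-β)) volume a b := fun d a b => by
    have := (intervalIntegrable_abs_rpow_neg hβ1 (a - d) (b - d)).comp_sub_right d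
    simpa using this
  have hk' : ∀ d a b : ℝ, IntervalIntegrable (fun s : ℝ => |s + d| ^ (-β)) volume a b := fun d a b => by
    simpa using hk (-d) a b
  have hkm : ∀ (d a b : ℝ) (g : ℝ → ℝ), Continuous g →
      IntervalIntegrable (fun s : ℝ => |s - d| ^ (-β) * g s) volume a b :=
    fun d a b g hg => (hk d a b).mul_continuousOn hg.continuousOn
  have hkm' : ∀ (d a b : ℝ) (g : ℝ → ℝ), Continuous g →
      IntervalIntegrable (fun s : ℝ => |s + d| ^ (-β) * g s) volume a b :=
    fun d a b g hg => (hk' d a b).mul_continuousOn hg.continuousOn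
  have hkm0 : ∀ (a b : ℝ) (g : ℝ → ℝ), Continuous g →
      IntervalIntegrable (fun s : ℝ => |s| ^ (-β) * g s) volume a b :=
    fun a b g hg => (intervalIntegrable_abs_rpow_neg hβ1 a b).mul_continuousOn hg.continuousOn
  have hknn : ∀ s : ℝ, 0 ≤ |s| ^ (-β) := fun s => Real.rpow_nonneg (abs_nonneg s) _
  -- shift both halves of the integral onto the interval `[m, π - m]`
  have hI1 : ∫ y in (0 : ℝ)..π, |y - h| ^ (-β) * u (y + m) =
      (∫ z in m..(π - m), |z - (m + h)| ^ (-β) * u z) +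
        ∫ z in (π - m)..(π + m), |z - (m + h)| ^ (-β) * u z := by
    rw [intervalIntegral.integral_add_adjacent_intervals (hkm _ _ _ _ hu) (hkm _ _ _ _ hu)]
    have := intervalIntegral.integral_comp_add_right (a := 0) (b := π)
      (fun z => |z - (m + h)| ^ (-β) * u z) m
    rw [zero_add] at this
    rw [← this]
    congr 1
    funext y
    rw [show y + m - (m + h) = y - h by ring]
  have hI2 : ∫ z in m..(π - m), |z + (m - h)| ^ (-β) * u z ≤
      ∫ y in (0 : ℝ)..π, |y - h| ^ (-β) * u (y - m) := by
    have := intervalIntegral.integral_comp_sub_right (a := 2 * m) (b := π)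
      (fun z => |z + (m - h)| ^ (-β) * u z) m
    rw [show 2 * m - m = m by ring] at this
    rw [← this]
    simp_rw [show ∀ y, y - m + (m - h) = y - h by intro y; ring]
    exact intervalIntegral.integral_mono_interval (by linarith) (by linarith) le_rfl
      (Eventually.of_forall fun y => mul_nonneg (hknn _) (H.nonneg _))
      (hkm _ _ _ (fun y => u (y - m)) (by fun_prop))
  have htail : ∫ z in (π - m)..(π + m), |z - (m + h)| ^ (-β) * u z ≤
      2 * m * (u π * (π / 2) ^ (-β)) := by
    have : ∫ z in (π - m)..(π + m), |z - (m + h)| ^ (-β) * u z ≤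
        ∫ z in (π - m)..(π + m), (π / 2) ^ (-β) * u π := by
      refine intervalIntegral.integral_mono_on (by linarith) (hkm _ _ _ _ hu)
        intervalIntegrable_const fun z hz => ?_
      refine mul_le_mul ?_ (H.le_apply_pi z) (H.nonneg z) (by positivity)
      refine Real.rpow_le_rpow_of_nonpos (by positivity) ?_ (by linarith)
      -- On the tail, z - (m+h) ≥ π - 3m ≥ π/2; this is where m ≤ π/6 is needed.
      exact le_trans (by linarith [hz.1]) (le_abs_self _)
    refine this.trans_eq ?_
    rw [intervalIntegral.integral_const, smul_eq_mul]
    ring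
  have hmid : (∫ z in m..(π - m), |z - (m + h)| ^ (-β) * u z) -
      ∫ z in m..(π - m), |z + (m - h)| ^ (-β) * u z ≤
      A * ((∫ z in m..(π - m), |z - (m + h)| ^ (-β) * (z + ε)) -
      ∫ z in m..(π - m), |z + (m - h)| ^ (-β) * (z + ε)) := by
    rw [← intervalIntegral.integral_sub (hkm _ _ _ _ hu) (hkm' _ _ _ _ hu),
      ← intervalIntegral.integral_sub (hkm _ _ _ (fun z => z + ε) (by fun_prop))
        (hkm' _ _ _ (fun z => z + ε) (by fun_prop)), ← intervalIntegral.integral_const_mul]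
    refine intervalIntegral.integral_mono_ae_restrict (by linarith)
      ((hkm _ _ _ _ hu).sub (hkm' _ _ _ _ hu))
      (((hkm _ _ _ (fun z => z + ε) (by fun_prop)).sub
        (hkm' _ _ _ (fun z => z + ε) (by fun_prop))).const_mul A) ?_
    have hne : ∀ᵐ z : ℝ, z ≠ m + h := by simp [ae_iff]
    refine (ae_restrict_iff' measurableSet_Icc).2 (hne.mono fun z hz hzI => ?_)
    have h1 : |z + (m - h)| ^ (-β) ≤ |z - (m + h)| ^ (-β) := by
      refine Real.rpow_le_rpow_of_nonpos (abs_pos.2 (sub_ne_zero.2 hz)) ?_ (by linarith)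
      rw [abs_of_nonneg (by linarith [hzI.1] : 0 ≤ z + (m - h))]
      -- The nontrivial side uses h ≤ m ≤ z.
      exact abs_le.2 ⟨by linarith [hzI.1], by linarith⟩
    have h2 := mul_le_mul_of_nonneg_left (hA z ⟨by linarith [hzI.1], by linarith [hzI.2]⟩)
      (sub_nonneg.2 h1)
    calc _ = (|z - (m + h)| ^ (-β) - |z + (m - h)| ^ (-β)) * u z := by ring
      _ ≤ _ := h2
      _ = _ := by ring
  have hJ1 : ∫ z in m..(π - m), |z - (m + h)| ^ (-β) * (z + ε) =
      (∫ w in (-h)..(2 * m - h), |w| ^ (-β) * (w + (m + h) + ε)) +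
        ∫ w in (2 * m - h)..(π - 2 * m - h), |w| ^ (-β) * (w + (m + h) + ε) := by
    rw [intervalIntegral.integral_add_adjacent_intervals
      (hkm0 _ _ (fun w => w + (m + h) + ε) (by fun_prop))
      (hkm0 _ _ (fun w => w + (m + h) + ε) (by fun_prop))]
    have := intervalIntegral.integral_comp_sub_right (a := m) (b := π - m)
      (fun w => |w| ^ (-β) * (w + (m + h) + ε)) (m + h)
    rw [show m - (m + h) = -h by ring, show π - m - (m + h) = π - 2 * m - h by ring] at this
    rw [← this]
    congr 1
    funext z
    rw [sub_add_cancel]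
  have hJ2 : ∫ w in (2 * m - h)..(π - 2 * m - h), |w| ^ (-β) * (w - (m - h) + ε) ≤
      ∫ z in m..(π - m), |z + (m - h)| ^ (-β) * (z + ε) := by
    have := intervalIntegral.integral_comp_add_right (a := m) (b := π - m)
      (fun w => |w| ^ (-β) * (w - (m - h) + ε)) (m - h)
    simp_rw [add_sub_cancel_right] at this
    rw [this, show m + (m - h) = 2 * m - h by ring, show π - m + (m - h) = π - h by ring]
    refine intervalIntegral.integral_mono_interval le_rfl (by linarith) (by linarith) ?_
      (hkm0 _ _ (fun w => w - (m - h) + ε) (by fun_prop))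
    refine (ae_restrict_iff' measurableSet_Ioc).2 (Eventually.of_forall fun w hw => ?_)
    exact mul_nonneg (hknn _) (by linarith [hw.1])
  have hJ3 : (∫ w in (2 * m - h)..(π - 2 * m - h), |w| ^ (-β) * (w + (m + h) + ε)) -
      ∫ w in (2 * m - h)..(π - 2 * m - h), |w| ^ (-β) * (w - (m - h) + ε) ≤ 2 * m * κ := by
    rw [← intervalIntegral.integral_sub (hkm0 _ _ (fun w => w + (m + h) + ε) (by fun_prop))
      (hkm0 _ _ (fun w => w - (m - h) + ε) (by fun_prop))]
    have e : ∀ w : ℝ, |w| ^ (-β) * (w + (m + h) + ε) - |w| ^ (-β) * (w - (m - h) + ε) =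
        2 * m * |w| ^ (-β) := fun w => by ring
    simp_rw [e]
    rw [intervalIntegral.integral_const_mul]
    exact mul_le_mul_of_nonneg_left
      (integral_abs_rpow_neg_le hβ1 (by linarith) (by linarith) (by linarith)) (by linarith)
  have hJ4 : ∫ w in (-h)..(2 * m - h), |w| ^ (-β) * (w + (m + h) + ε) ≤ (3 * m + ε) * κ := by
    have : ∫ w in (-h)..(2 * m - h), |w| ^ (-β) * (w + (m + h) + ε) ≤
        ∫ w in (-h)..(2 * m - h), (3 * m + ε) * |w| ^ (-β) := by
      refine intervalIntegral.integral_mono_on (by linarith)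
        (hkm0 _ _ (fun w => w + (m + h) + ε) (by fun_prop))
        ((intervalIntegrable_abs_rpow_neg hβ1 _ _).const_mul _) fun w hw => ?_
      rw [mul_comm]
      exact mul_le_mul_of_nonneg_right (by linarith [hw.2]) (hknn w)
    refine this.trans ?_
    rw [intervalIntegral.integral_const_mul]
    exact mul_le_mul_of_nonneg_left
      (integral_abs_rpow_neg_le hβ1 (by linarith) (by linarith) (by linarith)) (by linarith)
  have hsplit : ∫ y in (0 : ℝ)..π, |y - h| ^ (-β) * (u (y + m) - u (y - m)) =
      (∫ y in (0 : ℝ)..π, |y - h| ^ (-β) * u (y + m)) -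
        ∫ y in (0 : ℝ)..π, |y - h| ^ (-β) * u (y - m) := by
    rw [← intervalIntegral.integral_sub (hkm _ _ _ (fun y => u (y + m)) (by fun_prop))
      (hkm _ _ _ (fun y => u (y - m)) (by fun_prop))]
    simp_rw [mul_sub]
  have hJ : A * ((∫ z in m..(π - m), |z - (m + h)| ^ (-β) * (z + ε)) -
      ∫ z in m..(π - m), |z + (m - h)| ^ (-β) * (z + ε)) ≤ A * ((5 * m + ε) * κ) := by
    refine mul_le_mul_of_nonneg_left ?_ hA0
    rw [hJ1]
    linarith
  rw [hsplit, hI1]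
  linarith

theorem torusConv_sub_le (H : IsCrestProfile r u) (hr : 1 < r) {β c : ℝ}
    (hβ1 : β < 1) (hK : ∀ y ∈ Icc 0 π, ∀ h ∈ Icc 0 π, y ≠ h →
      torusKernel r (y - h) - torusKernel r (y + h) ≤ c * (h * |y - h| ^ (-β)))
    {m h : ℝ} (hm : m ∈ Icc 0 π) (hh : h ∈ Icc 0 π) :
    torusConv r u (m + h) - torusConv r u (m - h) ≤
      c * h * ∫ y in (0 : ℝ)..π, |y - h| ^ (-β) * (u (y + m) - u (y - m)) := by
  have hu := H.continuous
  have hKc := continuous_torusKernel hr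
  rw [torusConv_add_sub_torusConv_sub' hr H.continuous H.periodic H.even,
    ← intervalIntegral.integral_const_mul]
  have hk : IntervalIntegrable (fun s : ℝ => |s - h| ^ (-β)) volume 0 π := by
    have := (intervalIntegrable_abs_rpow_neg hβ1 (0 - h) (π - h)).comp_sub_right h
    simpa using this
  refine intervalIntegral.integral_mono_ae_restrict Real.pi_pos.le
    (by apply Continuous.intervalIntegrable; fun_prop)
    ((hk.mul_continuousOn (by fun_prop)).const_mul _) ?_
  have hne : ∀ᵐ z : ℝ, z ≠ h := by simp [ae_iff]
  refine (ae_restrict_iff' measurableSet_Icc).2 (hne.mono fun y hyh hy => ?_)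
  have := mul_le_mul_of_nonneg_right (hK y hy h hh hyh)
    (sub_nonneg.2 (H.apply_sub_le_apply_add hy hm))
  calc _ ≤ _ := this
    _ = _ := by ring

theorem integral_abs_rpow_mul_le_const (H : IsCrestProfile r u) {β : ℝ} (hβ1 : β < 1) {m h : ℝ}
    (hh : h ∈ Icc 0 π) : ∫ y in (0 : ℝ)..π, |y - h| ^ (-β) * (u (y + m) - u (y - m)) ≤
      u π * ∫ s in (-π)..π, |s| ^ (-β) := by
  have hu := H.continuous
  have hk : IntervalIntegrable (fun s : ℝ => |s - h| ^ (-β)) volume 0 π := by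
    have := (intervalIntegrable_abs_rpow_neg hβ1 (0 - h) (π - h)).comp_sub_right h
    simpa using this
  have h1 : ∫ y in (0 : ℝ)..π, |y - h| ^ (-β) * (u (y + m) - u (y - m)) ≤
      ∫ y in (0 : ℝ)..π, u π * |y - h| ^ (-β) := by
    refine intervalIntegral.integral_mono_on Real.pi_pos.le (hk.mul_continuousOn (by fun_prop))
      (hk.const_mul _) fun y hy => ?_
    rw [mul_comm]
    refine mul_le_mul_of_nonneg_right ?_ (Real.rpow_nonneg (abs_nonneg _) _)
    linarith [H.nonneg (y - m), H.le_apply_pi (y + m)]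
  refine h1.trans ?_
  rw [intervalIntegral.integral_const_mul,
    intervalIntegral.integral_comp_sub_right (fun s => |s| ^ (-β))]
  exact mul_le_mul_of_nonneg_left (integral_abs_rpow_neg_le hβ1 (by linarith [hh.2])
    (by linarith [Real.pi_pos]) (by linarith [hh.1])) (H.nonneg _)

end IsCrestProfile

theorem exists_torusKernel_sub_le_rpow {r : ℝ} (hr : 1 < r) : ∃ β : ℝ, 0 < β ∧ β < 1 ∧ ∃ c > 0,
    ∀ y ∈ Icc 0 π, ∀ h ∈ Icc 0 π, y ≠ h →
      torusKernel r (y - h) - torusKernel r (y + h) ≤ c * (h * |y - h| ^ (-β)) := by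
  obtain ⟨β, h1, h2⟩ := exists_between (max_lt one_pos (by linarith) : max 0 (2 - r) < 1)
  rw [max_lt_iff] at h1
  exact ⟨β, h1.1, h2, exists_torusKernel_sub_le hr h1.1 h2 h1.2⟩

namespace IsCrestProfile

variable {r : ℝ} {u : ℝ → ℝ}

/-- The shift by ε makes the maximum of u/(x+ε) finite before linear decay is known. Evaluating u²
at the maximiser bounds A² by a constant times A, uniformly in ε. -/
theorem exists_le_mul (H : IsCrestProfile r u) (hr : 1 < r) :
    ∃ A > 0, ∀ x ∈ Icc 0 π, u x ≤ A * x := by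
  obtain ⟨β, hβ0, hβ1, c, hc, hK⟩ := exists_torusKernel_sub_le_rpow hr
  have hpi := Real.pi_gt_three
  have hM := H.pos
  set κ := ∫ s in (-π)..π, |s| ^ (-β) with hκ
  have hκ0 : 0 ≤ κ := intervalIntegral.integral_nonneg (by linarith)
    fun s _ => Real.rpow_nonneg (abs_nonneg s) _
  set p := (π / 2) ^ (-β) with hp
  have hp0 : 0 < p := by positivity
  set B := c * (5 / 2 * κ + u π * p) + 1 + u π with hB
  have hBpos : 0 < B := by positivity
  refine ⟨B, hBpos, fun x hx => ?_⟩
  suffices h : ∀ ε > 0, u x ≤ B * (x + ε) by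
    refine le_of_forall_pos_le_add fun δ hδ => ?_
    have := h (δ / B) (by positivity)
    rwa [mul_add, mul_div_cancel₀ _ hBpos.ne'] at this
  intro ε hε
  obtain ⟨x₀, hx₀, hmax⟩ := isCompact_Icc.exists_isMaxOn (nonempty_Icc.2 Real.pi_pos.le)
    (f := fun z => u z / (z + ε)) (s := Icc 0 π)
    (H.continuous.continuousOn.div (by fun_prop) fun z hz => by linarith [hz.1])
  set A := u x₀ / (x₀ + ε) with hA
  have hx₀0 := hx₀.1
  have hX : 0 < x₀ + ε := by linarith
  have hA0 : 0 ≤ A := div_nonneg (H.nonneg _) hX.le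
  have hAle : ∀ z ∈ Icc 0 π, u z ≤ A * (z + ε) := fun z hz =>
    (div_le_iff₀ (by linarith [hz.1])).1 (hmax hz)
  have hAeq : A * (x₀ + ε) = u x₀ := div_mul_cancel₀ _ hX.ne'
  have hAB : A ≤ B := by
    rcases le_total x₀ (π / 3) with h | h
    · rcases le_total A 1 with hA1 | hA1
      -- When A ≤ 1 there is nothing to prove; when A ≥ 1 the tail term, which lacks a factor A, can
      -- be multiplied by A.
      · exact hA1.trans (by rw [hB]; have : 0 ≤ c * (5 / 2 * κ + u π * p) + u π := by positivity
                            linarith)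
      have h1 := H.torusConv_sub_le hr hβ1 hK (m := x₀ / 2) (h := x₀ / 2)
        ⟨by linarith, by linarith⟩ ⟨by linarith, by linarith⟩
      have h2 := H.integral_abs_rpow_mul_le hβ0 hβ1 hε.le hA0 hAle (m := x₀ / 2) (h := x₀ / 2)
        (by linarith) le_rfl (by linarith)
      rw [add_halves, sub_self] at h1
      have h3 := H.sq_eq x₀
      have h4 : u x₀ ^ 2 ≤ c * x₀ * (A * ((5 * (x₀ / 2) + ε) * κ) + 2 * (x₀ / 2) * (u π * p)) := by
        have := mul_le_mul_of_nonneg_left h2 (by positivity : 0 ≤ c * (x₀ / 2))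
        linarith
      have h5 : c * x₀ * (A * ((5 * (x₀ / 2) + ε) * κ) + 2 * (x₀ / 2) * (u π * p)) ≤
          c * (x₀ + ε) * (A * ((5 / 2 * (x₀ + ε)) * κ) + (x₀ + ε) * (A * (u π * p))) := by
        have e1 : 5 * (x₀ / 2) + ε ≤ 5 / 2 * (x₀ + ε) := by linarith
        have e2 : u π * p ≤ A * (u π * p) := le_mul_of_one_le_left (by positivity) hA1
        have e3 : 2 * (x₀ / 2) ≤ x₀ + ε := by linarith
        have e4 : x₀ ≤ x₀ + ε := by linarith
        gcongr
      rw [← hAeq] at h4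
      have h6 : A * (A * (x₀ + ε) ^ 2) ≤ (c * (5 / 2 * κ + u π * p)) * (A * (x₀ + ε) ^ 2) := by
        linarith
      have h7 := le_of_mul_le_mul_right h6 (by positivity)
      linarith
    -- Far from the crest x₀ ≥ π/3 > 1, so A ≤ u(x₀) ≤ u(π).
    · have h1 : A * 1 ≤ A * (x₀ + ε) := mul_le_mul_of_nonneg_left (by linarith) hA0
      have h2 := H.le_apply_pi x₀
      have h3 : 0 ≤ c * (5 / 2 * κ + u π * p) + 1 := by positivity
      linarith
  exact (hAle x hx).trans (mul_le_mul_of_nonneg_right hAB (by linarith [hx.1]))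

/-- The degeneracy of the square root at the crest is compensated exactly: with m the midpoint,
u(y)² - u(x)² is O((y-x) m), while u(x) + u(y) ≥ 2am. -/
theorem exists_sub_le_mul_sub (H : IsCrestProfile r u) (hr : 1 < r) :
    ∃ C > 0, ∀ x ∈ Icc 0 π, ∀ y ∈ Icc 0 π, x ≤ y → u y - u x ≤ C * (y - x) := by
  obtain ⟨β, hβ0, hβ1, c, hc, hK⟩ := exists_torusKernel_sub_le_rpow hr
  obtain ⟨A, hA0, hA⟩ := H.exists_le_mul hr
  obtain ⟨a, ha0, ha⟩ := H.exists_mul_le hr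
  have hpi := Real.pi_gt_three
  have hM := H.pos
  set κ := ∫ s in (-π)..π, |s| ^ (-β) with hκ
  have hκ0 : 0 ≤ κ := intervalIntegral.integral_nonneg (by linarith)
    fun s _ => Real.rpow_nonneg (abs_nonneg s) _
  set p := (π / 2) ^ (-β) with hp
  have hp0 : 0 < p := by positivity
  set B := A * (5 * κ) + 2 * (u π * p) + 2 * (u π * κ) with hB
  have hB0 : 0 < B := by positivity
  refine ⟨c * B / (2 * a), by positivity, fun x hx y hy hxy => ?_⟩
  rcases hxy.eq_or_lt with rfl | hlt
  · simp
  obtain ⟨m, hm⟩ : ∃ m, m = (x + y) / 2 := ⟨_, rfl⟩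
  obtain ⟨h, hh⟩ : ∃ h, h = (y - x) / 2 := ⟨_, rfl⟩
  have hx0 := hx.1
  have hy1 := hy.2
  have hm0 : 0 < m := by linarith
  have hh0 : 0 < h := by linarith
  have hhI : h ∈ Icc 0 π := ⟨hh0.le, by linarith⟩
  have h1 := H.torusConv_sub_le hr hβ1 hK (m := m) (h := h) ⟨hm0.le, by linarith⟩ hhI
  have h2 : ∫ z in (0 : ℝ)..π, |z - h| ^ (-β) * (u (z + m) - u (z - m)) ≤ B * m := by
    rcases le_total m (π / 6) with hmle | hmle
    · have h2 := H.integral_abs_rpow_mul_le hβ0 hβ1 (ε := 0) le_rfl hA0.le (by simpa using hA)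
        (m := m) (h := h) hh0.le (by linarith) hmle
      refine h2.trans ?_
      have : 0 ≤ 2 * (u π * κ) * m := by positivity
      rw [hB]
      linarith
    -- For m ≥ π/6 > 1/2 a bounded integral is already at most a constant times m.
    · refine (H.integral_abs_rpow_mul_le_const hβ1 hhI).trans ?_
      have h3 : 1 ≤ 2 * m := by linarith
      have h4 : u π * κ * 1 ≤ u π * κ * (2 * m) := by gcongr
      have : 0 ≤ (A * (5 * κ) + 2 * (u π * p)) * m := by positivity
      rw [hB]
      linarith
  have h3 := mul_le_mul_of_nonneg_left h2 (by positivity : 0 ≤ c * h)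
  rw [show m + h = y by rw [hm, hh]; ring, show m - h = x by rw [hm, hh]; ring] at h1
  have h4 : (u y - u x) * (u y + u x) ≤ 2 * (c * h * (B * m)) := by
    have e1 := H.sq_eq x
    have e2 := H.sq_eq y
    nlinarith
  have h5 : 2 * a * m ≤ u y + u x := by
    have := ha x hx; have := ha y hy
    rw [hm]; linarith
  have h6 : (u y - u x) * (2 * a * m) ≤ (u y - u x) * (u y + u x) :=
    mul_le_mul_of_nonneg_left h5 (sub_nonneg.2 (H.monotoneOn hx hy hxy))
  have h7 : (u y - u x) * (2 * a) * m ≤ c * B * (y - x) * m := by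
    rw [show y - x = 2 * h by rw [hh]; ring]
    linarith
  have h8 := le_of_mul_le_mul_right h7 hm0
  rw [div_mul_eq_mul_div, le_div_iff₀ (by positivity)]
  exact h8

theorem exists_lipschitzWith (H : IsCrestProfile r u) (hr : 1 < r) :
    ∃ C : NNReal, LipschitzWith C u := by
  obtain ⟨C, hC, hL⟩ := H.exists_sub_le_mul_sub hr
  have key : ∀ x ∈ Icc 0 π, ∀ y ∈ Icc 0 π, |u x - u y| ≤ C * |x - y| := by
    intro x hx y hy
    rcases le_total x y with h | h
    · rw [abs_sub_comm, abs_sub_comm x, abs_of_nonneg (sub_nonneg.2 (H.monotoneOn hx hy h)),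
        abs_of_nonneg (sub_nonneg.2 h)]
      exact hL x hx y hy h
    · rw [abs_of_nonneg (sub_nonneg.2 (H.monotoneOn hy hx h)), abs_of_nonneg (sub_nonneg.2 h)]
      exact hL y hy x hx h
  refine ⟨⟨C, hC.le⟩, LipschitzWith.of_dist_le_mul fun x y => ?_⟩
  rw [Real.dist_eq, Real.dist_eq, apply_eq_apply_norm H.periodic H.even x,
    apply_eq_apply_norm H.periodic H.even y]
  refine (key _ (norm_coe_mem_Icc x) _ (norm_coe_mem_Icc y)).trans ?_
  refine mul_le_mul_of_nonneg_left ?_ hC.le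
  -- The folding map x ↦ ‖x‖ on the circle is 1-Lipschitz, so the constant from [0, π] survives.
  refine (abs_norm_sub_norm_le _ _).trans ?_
  rw [← AddCircle.coe_sub]
  exact QuotientAddGroup.norm_mk_le_norm

end IsCrestProfile

/-! ### Local gain of one derivative and smoothness away from the crest. -/

theorem antitoneOn_torusKernel {r : ℝ} (hr : 1 < r) : AntitoneOn (torusKernel r) (Icc 0 π) := by
  obtain ⟨c, hc, hK⟩ := exists_mul_sin_mul_sin_le_torusKernel_sub hr
  intro x hx y hy hxy
  have hm : (x + y) / 2 ∈ Icc 0 π := ⟨by linarith [hx.1, hy.1], by linarith [hx.2, hy.2]⟩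
  have hh : (y - x) / 2 ∈ Icc 0 π := ⟨by linarith, by linarith [hx.1, hy.2, Real.pi_pos]⟩
  have h := hK _ hm _ hh
  rw [show (x + y) / 2 + (y - x) / 2 = y by ring, show (x + y) / 2 - (y - x) / 2 = x by ring] at h
  have := mul_nonneg hc.le
    (mul_nonneg (Real.sin_nonneg_of_mem_Icc hm) (Real.sin_nonneg_of_mem_Icc hh))
  linarith

/-- A monotone function has integrable derivative, so no asymptotics of K' at its singularity are
needed; oddness and periodicity of K' do the rest. -/
theorem intervalIntegrable_deriv_torusKernel {r : ℝ} (hr : 1 < r) (a b : ℝ) :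
    IntervalIntegrable (deriv (torusKernel r)) volume a b := by
  have h1 : IntervalIntegrable (deriv (torusKernel r)) volume 0 π := by
    have h : MonotoneOn (fun s => -torusKernel r s) (uIcc 0 π) := by
      rw [uIcc_of_le Real.pi_pos.le]
      exact (antitoneOn_torusKernel hr).neg
    have h2 := h.intervalIntegrable_deriv.neg
    simpa [deriv.fun_neg', Pi.neg_def] using h2
  have hodd : ∀ s, deriv (torusKernel r) (-s) = -deriv (torusKernel r) s := by
    intro s
    have h := deriv_comp_neg (torusKernel r) s
    have e : (fun x => torusKernel r (-x)) = torusKernel r := funext (torusKernel_neg r)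
    rw [e] at h
    linarith
  have h2 : IntervalIntegrable (deriv (torusKernel r)) volume (-π) 0 := by
    rw [IntervalIntegrable.iff_comp_neg]
    simp only [hodd, neg_neg, neg_zero]
    exact h1.symm.neg
  have hp : Function.Periodic (deriv (torusKernel r)) (2 * π) := by
    intro s
    have h := deriv_comp_add_const (torusKernel r) (2 * π) s
    have e : (fun x => torusKernel r (x + 2 * π)) = torusKernel r :=
      funext (periodic_torusKernel r)
    rw [e] at h
    exact h.symm
  refine hp.intervalIntegrable (t := -π) Real.two_pi_pos.ne' ?_ a b
  rw [show -π + 2 * π = π by ring]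
  exact h2.trans h1

theorem integral_deriv_torusKernel {r : ℝ} (hr : 1 < r) (a b : ℝ) :
    ∫ s in a..b, deriv (torusKernel r) s = torusKernel r b - torusKernel r a := by
  refine integral_eq_of_hasDerivAt_off_countable (torusKernel r) _ (s := {s | Real.cos s = 1}) ?_
    (continuous_torusKernel hr).continuousOn (fun s hs => ?_)
    (intervalIntegrable_deriv_torusKernel hr a b)
  · have : {s : ℝ | Real.cos s = 1} = range fun n : ℤ => (n : ℝ) * (2 * π) := by
      ext s; simp [Real.cos_eq_one_iff]
    rw [this]
    exact countable_range _
  · exact ((contDiffAt_torusKernel hr hs.2 (n := 1)).differentiableAt (by simp)).hasDerivAt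

theorem locallyIntegrable_deriv_torusKernel {r : ℝ} (hr : 1 < r) :
    LocallyIntegrable (deriv (torusKernel r)) := by
  rw [locallyIntegrable_iff]
  intro k hk
  obtain ⟨R, hR⟩ := hk.isBounded.subset_closedBall 0
  rw [Real.closedBall_eq_Icc] at hR
  refine IntegrableOn.mono_set ?_ hR
  rw [zero_sub, zero_add]
  rcases le_total (-R) R with h | h
  · exact (intervalIntegrable_iff_integrableOn_Icc_of_le h).1
      (intervalIntegrable_deriv_torusKernel hr _ _)
  · have : Icc (-R) R ⊆ {R} := by
      intro x hx
      simp only [mem_singleton_iff]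
      linarith [hx.1, hx.2]
    exact IntegrableOn.mono_set (by simp) this

/-- Write K(x-y) - K(-y) as an integral of K' and exchange the integrals. Fubini applies because the
integrand agrees on the rectangle with a convolution integrand of two integrable functions. -/
theorem integral_mul_torusKernel_sub {r : ℝ} (hr : 1 < r) {g : ℝ → ℝ} (hg : Continuous g)
    {a b : ℝ} (x : ℝ) :
    (∫ y in a..b, g y * torusKernel r (x - y)) - ∫ y in a..b, g y * torusKernel r (0 - y) =
      ∫ s in (0 : ℝ)..x, ∫ y in a..b, g y * deriv (torusKernel r) (s - y) := by
  have hK := continuous_torusKernel hr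
  have hint : IntegrableOn (Function.uncurry fun s y => g y * deriv (torusKernel r) (s - y))
      (uIoc 0 x ×ˢ uIoc a b) := by
    obtain ⟨R, hR⟩ : ∃ R, ∀ s ∈ uIoc 0 x, ∀ y ∈ uIoc a b, |s - y| ≤ R := by
      obtain ⟨R, hR⟩ := (isCompact_uIcc.prod isCompact_uIcc).exists_bound_of_continuousOn
        (s := uIcc 0 x ×ˢ uIcc a b) (f := fun p : ℝ × ℝ => p.1 - p.2) (by fun_prop)
      exact ⟨R, fun s hs y hy => hR (s, y) ⟨uIoc_subset_uIcc hs, uIoc_subset_uIcc hy⟩⟩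
    have i1 : Integrable ((uIoc a b).indicator g) :=
      ((hg.continuousOn.integrableOn_compact isCompact_uIcc).mono_set
        uIoc_subset_uIcc).integrable_indicator measurableSet_uIoc
    have i2 : Integrable ((Metric.closedBall 0 R).indicator (deriv (torusKernel r))) :=
      ((locallyIntegrable_deriv_torusKernel hr).integrableOn_isCompact
        (isCompact_closedBall 0 R)).integrable_indicator measurableSet_closedBall
    have i3 := (i1.convolution_integrand (ContinuousLinearMap.mul ℝ ℝ) i2).integrableOn
      (s := uIoc 0 x ×ˢ uIoc a b)
    refine i3.congr_fun (fun p hp => ?_) (measurableSet_uIoc.prod measurableSet_uIoc)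
    have h1 : p.1 - p.2 ∈ Metric.closedBall (0 : ℝ) R := by
      rw [mem_closedBall_zero_iff]; exact hR _ hp.1 _ hp.2
    simp only [ContinuousLinearMap.mul_apply', indicator_of_mem hp.2, indicator_of_mem h1,
      Function.uncurry]
  rw [intervalIntegral_intervalIntegral_swap hint, ← intervalIntegral.integral_sub
    (by apply Continuous.intervalIntegrable; fun_prop)
    (by apply Continuous.intervalIntegrable; fun_prop)]
  congr 1
  funext y
  rw [intervalIntegral.integral_const_mul,
    intervalIntegral.integral_comp_sub_right (fun s => deriv (torusKernel r) s),
    integral_deriv_torusKernel hr]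
  ring

theorem contDiff_succ_integral_mul_torusKernel {r : ℝ} (hr : 1 < r) {g : ℝ → ℝ} {n : ℕ∞}
    (hg : ContDiff ℝ n g) (hgc : HasCompactSupport g) {a b : ℝ}
    (hs : Function.support g ⊆ Ioc a b) :
    ContDiff ℝ (n + 1) fun x => ∫ y in a..b, g y * torusKernel r (x - y) := by
  set G : ℝ → ℝ := fun s => ∫ y in a..b, g y * deriv (torusKernel r) (s - y) with hG
  have hGc : ContDiff ℝ n G := by
    have h := hgc.contDiff_convolution_left (ContinuousLinearMap.mul ℝ ℝ) hg
      (locallyIntegrable_deriv_torusKernel hr)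
    convert h using 1
    funext s
    rw [convolution_def, hG]
    refine intervalIntegral.integral_eq_integral_of_support_subset fun y hy => hs fun h0 => hy ?_
    simp [h0]
  have e : (fun x => ∫ y in a..b, g y * torusKernel r (x - y)) =
      fun x => (∫ y in a..b, g y * torusKernel r (0 - y)) + ∫ s in (0 : ℝ)..x, G s := by
    funext x
    rw [hG, ← integral_mul_torusKernel_sub hr hg.continuous x]
    ring
  rw [e]
  refine contDiff_const.add ?_
  have hd : deriv (fun x => ∫ s in (0 : ℝ)..x, G s) = G :=
    funext fun x => hGc.continuous.deriv_integral G 0 x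
  rw [contDiff_succ_iff_deriv, hd]
  exact ⟨fun x => (hGc.continuous.integral_hasStrictDerivAt 0 x).hasDerivAt.differentiableAt,
    fun h => absurd h (by simp), hGc⟩

/-- Split u = χu + (1-χ)u with χ a bump at x₀. The first piece is C^n and gains a derivative from
integrability of K'; the second, for x near x₀, only meets K away from its singularities, where K is
smooth. -/
theorem contDiffAt_succ_torusConv {r : ℝ} (hr : 1 < r) {u : ℝ → ℝ} (hc : Continuous u)
    (hp : Function.Periodic u (2 * π)) {n : ℕ∞} {x₀ : ℝ}
    (h : ∀ᶠ x in 𝓝 x₀, ContDiffAt ℝ n u x) : ContDiffAt ℝ (n + 1) (torusConv r u) x₀ := by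
  have hpi := Real.pi_gt_three
  obtain ⟨δ, hδ0, hδ⟩ := Metric.eventually_nhds_iff.1 h
  obtain ⟨ε, hε0, hε1, hεδ⟩ : ∃ ε : ℝ, 0 < ε ∧ ε ≤ 1 ∧ 2 * ε < δ :=
    ⟨min 1 (δ / 4), by positivity, min_le_left _ _, by linarith [min_le_right 1 (δ / 4)]⟩
  let χ : ContDiffBump x₀ := ⟨ε, 2 * ε, hε0, by linarith⟩
  -- b₁ - b₂ equals 1 for ε/2 ≤ |s| ≤ π + 1, which covers all x - y in play. b₂ removes the
  -- singularity at 0; b₁ vanishes beyond π + 2 < 2π, which removes the others and gives compact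
  -- support.
  let b₁ : ContDiffBump (0 : ℝ) := ⟨π + 1, π + 2, by linarith, by linarith⟩
  let b₂ : ContDiffBump (0 : ℝ) := ⟨ε / 4, ε / 2, by linarith, by linarith⟩
  set a := x₀ - π with ha
  set b := x₀ - π + 2 * π with hb
  have hab : a ≤ b := by linarith
  set g : ℝ → ℝ := fun y => χ y * u y with hg
  set w : ℝ → ℝ := (Ioc a b).indicator fun y => (1 - χ y) * u y with hw
  set κ : ℝ → ℝ := fun s => (b₁ s - b₂ s) * torusKernel r s with hκ
  have hK := continuous_torusKernel hr
  have hχc : Continuous χ := χ.continuous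
  have hsupp : Function.support g ⊆ Ioc a b := by
    intro y hy
    have h1 : χ y ≠ 0 := fun h0 => hy (by simp [hg, h0])
    have h2 : dist y x₀ < 2 * ε := by
      by_contra h3
      exact h1 (χ.zero_of_le_dist (not_lt.1 h3))
    rw [Real.dist_eq, abs_lt] at h2
    exact ⟨by linarith [h2.1], by linarith [h2.2]⟩
  have hgc : HasCompactSupport g := χ.hasCompactSupport.mul_right
  have hgn : ContDiff ℝ n g := by
    refine contDiff_iff_contDiffAt.2 fun y => ?_
    by_cases hy : dist y x₀ ≤ 2 * ε
    · exact χ.contDiff.contDiffAt.mul (hδ (by linarith))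
    · have : g =ᶠ[𝓝 y] fun _ => 0 := by
        have ho : {z | 2 * ε < dist z x₀} ∈ 𝓝 y :=
          (isOpen_lt continuous_const (by fun_prop)).mem_nhds (not_le.1 hy)
        filter_upwards [ho] with z hz
        simp only [hg]
        rw [χ.zero_of_le_dist (le_of_lt hz), zero_mul]
      exact contDiffAt_const.congr_of_eventuallyEq this
  have hκn : ContDiff ℝ (n + 1) κ := by
    refine contDiff_iff_contDiffAt.2 fun s => ?_
    by_cases hs : Real.cos s = 1
    · have : κ =ᶠ[𝓝 s] fun _ => 0 := by
        obtain ⟨k, hk⟩ := (Real.cos_eq_one_iff s).1 hs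
        rcases eq_or_ne k 0 with rfl | hk0
        · have hs0 : s = 0 := by rw [← hk]; simp
          subst hs0
          filter_upwards [Metric.ball_mem_nhds (0 : ℝ) (by linarith : 0 < ε / 4)] with z hz
          have hz' : dist z 0 < ε / 4 := hz
          have e1 : b₁ z = 1 := b₁.one_of_mem_closedBall
            (Metric.mem_closedBall.2 (show dist z 0 ≤ π + 1 by linarith))
          have e2 : b₂ z = 1 := b₂.one_of_mem_closedBall
            (Metric.mem_closedBall.2 (show dist z 0 ≤ ε / 4 by linarith))
          simp [hκ, e1, e2]
        · have habs : π + 2 < |s| := by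
            rw [← hk, abs_mul, abs_of_pos Real.two_pi_pos]
            have : (1 : ℝ) ≤ |(k : ℝ)| := by exact_mod_cast Int.one_le_abs hk0
            nlinarith
          have ho : {z : ℝ | π + 2 < |z|} ∈ 𝓝 s :=
            (isOpen_lt continuous_const continuous_abs).mem_nhds habs
          filter_upwards [ho] with z hz
          have hz' : π + 2 < |z| := hz
          have e1 : b₁ z = 0 := b₁.zero_of_le_dist
            (show π + 2 ≤ dist z 0 by rw [Real.dist_0_eq_abs]; linarith)
          have e2 : b₂ z = 0 := b₂.zero_of_le_dist
            (show ε / 2 ≤ dist z 0 by rw [Real.dist_0_eq_abs]; linarith)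
          simp [hκ, e1, e2]
      exact contDiffAt_const.congr_of_eventuallyEq this
    · exact (b₁.contDiff (n := n + 1)).contDiffAt.sub (b₂.contDiff (n := n + 1)).contDiffAt |>.mul
        (contDiffAt_torusKernel hr hs)
  have hκc : HasCompactSupport κ := by
    refine HasCompactSupport.mul_right (HasCompactSupport.intro (isCompact_closedBall 0 (π + 2))
      fun z hz => ?_)
    rw [Metric.mem_closedBall, not_le] at hz
    rw [b₁.zero_of_le_dist hz.le, b₂.zero_of_le_dist (show ε / 2 ≤ dist z 0 by linarith), sub_zero]
  have hwi : LocallyIntegrable w := by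
    refine Integrable.locallyIntegrable (IntegrableOn.integrable_indicator ?_ measurableSet_Ioc)
    exact ((by fun_prop : Continuous fun y => (1 - χ y) * u y).continuousOn.integrableOn_compact
      isCompact_Icc).mono_set Ioc_subset_Icc_self
  have hfar : ContDiff ℝ (n + 1) fun x => ∫ y, w y * κ (x - y) :=
    hκc.contDiff_convolution_right (ContinuousLinearMap.mul ℝ ℝ) hwi (n := n + 1)
      (by exact_mod_cast hκn)
  have hnear := contDiff_succ_integral_mul_torusKernel hr hgn hgc hsupp
  refine (hnear.add hfar).contDiffAt.congr_of_eventuallyEq ?_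
  filter_upwards [Metric.ball_mem_nhds x₀ (by linarith : 0 < ε / 2)] with x hx
  rw [Metric.mem_ball, Real.dist_eq, abs_lt] at hx
  have e1 : ∫ y, w y * κ (x - y) = ∫ y in a..b, ((1 - χ y) * u y) * torusKernel r (x - y) := by
    rw [intervalIntegral.integral_of_le hab, ← integral_indicator measurableSet_Ioc]
    congr 1
    funext y
    by_cases hy : y ∈ Ioc a b
    · simp only [hw, indicator_of_mem hy]
      by_cases hy2 : dist y x₀ ≤ ε
      · rw [χ.one_of_mem_closedBall hy2]; simp
      · have hy3 : ε < |y - x₀| := by rwa [Real.dist_eq, not_le] at hy2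
        have h1 : ε / 2 ≤ dist (x - y) 0 := by
          rw [Real.dist_0_eq_abs]
          rcases lt_abs.1 hy3 with h | h
          · exact le_trans (by linarith [hx.2]) (neg_le_abs _)
          · exact le_trans (by linarith [hx.1]) (le_abs_self _)
        have h2 : dist (x - y) 0 ≤ π + 1 := by
          rw [Real.dist_0_eq_abs]
          exact abs_le.2 ⟨by linarith [hx.1, hy.2], by linarith [hx.2, hy.1]⟩
        simp only [hκ]
        rw [b₁.one_of_mem_closedBall h2, b₂.zero_of_le_dist h1, sub_zero, one_mul]
    · simp only [hw, indicator_of_notMem hy, zero_mul]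
  rw [e1, torusConv_eq_window hp x a, ← intervalIntegral.integral_add
    (by apply Continuous.intervalIntegrable; fun_prop)
    (by apply Continuous.intervalIntegrable; fun_prop)]
  congr 1
  funext y
  simp only [hg]
  ring

namespace IsCrestProfile

variable {r : ℝ} {u : ℝ → ℝ}

theorem apply_pos (H : IsCrestProfile r u) (hr : 1 < r) {x : ℝ} (hx : Real.cos x ≠ 1) :
    0 < u x := by
  have h0 : ‖(x : AddCircle (2 * π))‖ ≠ 0 := by
    rw [norm_ne_zero_iff]
    intro h
    obtain ⟨k, hk⟩ := (AddCircle.coe_eq_zero_iff (2 * π)).1 h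
    exact hx ((Real.cos_eq_one_iff x).2 ⟨k, by rw [← hk]; simp⟩)
  obtain ⟨c, hc, hL⟩ := H.exists_mul_le hr
  rw [apply_eq_apply_norm H.periodic H.even]
  exact lt_of_lt_of_le (mul_pos hc (lt_of_le_of_ne (norm_nonneg _) h0.symm))
    (hL _ (norm_coe_mem_Icc x))

theorem contDiffAt_nat (H : IsCrestProfile r u) (hr : 1 < r) (n : ℕ) :
    ∀ x, Real.cos x ≠ 1 → ContDiffAt ℝ ((n : ℕ∞) : WithTop ℕ∞) u x := by
  induction n with
  | zero => exact fun x _ => (contDiff_zero.2 H.continuous).contDiffAt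
  | succ n ih =>
    intro x hx
    have hev : ∀ᶠ z in 𝓝 x, ContDiffAt ℝ ((n : ℕ∞) : WithTop ℕ∞) u z := by
      have : {z : ℝ | Real.cos z ≠ 1} ∈ 𝓝 x :=
        (isOpen_ne_fun Real.continuous_cos continuous_const).mem_nhds hx
      filter_upwards [this] with z hz using ih z hz
    have h1 := contDiffAt_succ_torusConv hr H.continuous H.periodic hev
    -- Positivity of u off 2πℤ keeps the argument of the root nonzero, so u inherits the derivative
    -- gained by the convolution.
    have e : u = fun z => √(2 * (torusConv r u z - torusConv r u 0)) := by
      funext z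
      rw [← H.sq_eq, Real.sqrt_sq (H.nonneg z)]
    have h2 : 2 * (torusConv r u x - torusConv r u 0) ≠ 0 := by
      rw [← H.sq_eq]
      exact pow_ne_zero 2 (H.apply_pos hr hx).ne'
    have h3 := (contDiffAt_const.mul (h1.sub contDiffAt_const)).sqrt h2
    rw [e]
    exact_mod_cast h3

theorem contDiffAt_of_cos_ne_one (H : IsCrestProfile r u) (hr : 1 < r) {x : ℝ} (hx : Real.cos x ≠ 1) :
    ContDiffAt ℝ ∞ u x :=
  contDiffAt_infty.2 fun n => by exact_mod_cast H.contDiffAt_nat hr n x hx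

end IsCrestProfile

/-! ### From steady solutions to crest profiles. -/

namespace IsSteadySolution

variable {r μ : ℝ} {φ : ℝ → ℝ}

theorem real_equation (hsol : IsSteadySolution r μ φ) (hr : 1 < r) (x : ℝ) :
    -μ * φ x + torusConv r φ x + 1 / 2 * φ x ^ 2
      - 1 / 2 * (1 / (2 * π) * ∫ y in (-π)..π, φ y ^ 2) = 0 := by
  obtain ⟨M, hM⟩ := hsol.bounded
  have h := hsol.equation x
  rw [Lmult_eq_torusConv hr hsol.measurable hM, torusCoeff_eq] at h
  have e : ∫ y in (-π)..π, Complex.exp (-(Complex.I * ((0 : ℤ) : ℂ) * y)) * ((φ y ^ 2 : ℝ) : ℂ) =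
      ((∫ y in (-π)..π, φ y ^ 2 : ℝ) : ℂ) := by
    rw [← intervalIntegral.integral_ofReal]
    congr 1
    funext y
    simp
  rw [e] at h
  generalize ∫ y in (-π)..π, φ y ^ 2 = q at h ⊢
  apply Complex.ofReal_injective
  push_cast
  exact h

theorem sq_sub_eq (hsol : IsSteadySolution r μ φ) (hr : 1 < r) (hmax : φ 0 = μ) (x : ℝ) :
    (μ - φ x) ^ 2 = 2 * (torusConv r φ 0 - torusConv r φ x) := by
  have h0 := hsol.real_equation hr 0
  have hx := hsol.real_equation hr x
  rw [hmax] at h0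
  linear_combination 2 * hx - 2 * h0

/-- The condition φ ≤ μ selects one branch of the square root, so continuity of the convolution
passes to the merely measurable φ. -/
theorem continuous (hsol : IsSteadySolution r μ φ) (hr : 1 < r) (hle : ∀ x, φ x ≤ μ)
    (hmax : φ 0 = μ) : Continuous φ := by
  obtain ⟨M, hM⟩ := hsol.bounded
  have hT := continuous_torusConv hr hsol.measurable hM
  have e : φ = fun x => μ - √(2 * (torusConv r φ 0 - torusConv r φ x)) := by
    funext x
    rw [← hsol.sq_sub_eq hr hmax, Real.sqrt_sq (sub_nonneg.2 (hle x))]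
    ring
  rw [e]
  fun_prop

/-- Integrated over a period, the convolution vanishes and the quadratic term cancels its mean,
leaving μ ∫ φ = 0. -/
theorem integral_eq_zero (hsol : IsSteadySolution r μ φ) (hr : 1 < r) (hμ : 0 < μ)
    (hc : Continuous φ) : ∫ x in (-π)..π, φ x = 0 := by
  obtain ⟨M, hM⟩ := hsol.bounded
  have hT := continuous_torusConv hr hsol.measurable hM
  set q := ∫ y in (-π)..π, φ y ^ 2 with hq
  have h : ∫ x in (-π)..π, (-μ * φ x + torusConv r φ x + 1 / 2 * φ x ^ 2
      - 1 / 2 * (1 / (2 * π) * q)) = 0 := by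
    simp only [hq, hsol.real_equation hr, intervalIntegral.integral_zero]
  rw [intervalIntegral.integral_sub (by apply Continuous.intervalIntegrable; fun_prop)
      (by apply Continuous.intervalIntegrable; fun_prop),
    intervalIntegral.integral_add (by apply Continuous.intervalIntegrable; fun_prop)
      (by apply Continuous.intervalIntegrable; fun_prop),
    intervalIntegral.integral_add (by apply Continuous.intervalIntegrable; fun_prop)
      (by apply Continuous.intervalIntegrable; fun_prop),
    integral_torusConv hr hc, intervalIntegral.integral_const_mul,
    intervalIntegral.integral_const_mul, intervalIntegral.integral_const, smul_eq_mul, ← hq] at h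
  have e : (π - -π) * (1 / 2 * (1 / (2 * π) * q)) = 1 / 2 * q := by field_simp; ring
  rw [e] at h
  have h2 : μ * ∫ x in (-π)..π, φ x = 0 := by linarith
  exact (mul_eq_zero.1 h2).resolve_left hμ.ne'

theorem isCrestProfile (hsol : IsSteadySolution r μ φ) (hr : 1 < r) (hμ : 0 < μ)
    (heven : Function.Even φ) (hmono : MonotoneOn φ (Icc (-π) 0)) (hle : ∀ x, φ x ≤ μ)
    (hmax : φ 0 = μ) : IsCrestProfile r fun x => μ - φ x := by
  have hc := hsol.continuous hr hle hmax
  have hK := continuous_torusKernel hr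
  have hconv : ∀ x, torusConv r (fun x => μ - φ x) x = -torusConv r φ x := by
    intro x
    have h0 := torusConv_const hr μ x
    simp only [torusConv, mul_sub] at h0 ⊢
    rw [intervalIntegral.integral_sub (by apply Continuous.intervalIntegrable; fun_prop)
      (by apply Continuous.intervalIntegrable; fun_prop), h0, zero_sub]
  have hmon : MonotoneOn (fun x => μ - φ x) (Icc 0 π) := by
    intro x hx y hy hxy
    have h := hmono (a := -y) (b := -x) ⟨by linarith [hy.2], by linarith [hy.1]⟩
      ⟨by linarith [hx.2], by linarith [hx.1]⟩ (by linarith)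
    rw [heven, heven] at h
    simp only
    linarith
  have hper : Function.Periodic (fun x => μ - φ x) (2 * π) := fun x => by
    simp only [hsol.periodic x]
  have hev : Function.Even fun x => μ - φ x := fun x => by simp only [heven x]
  refine ⟨by fun_prop, hper, hev, hmon, by simp [hmax], ?_, fun x => ?_⟩
  -- Were the depth at π zero, monotonicity would force φ ≡ μ > 0, contradicting the zero mean.
  · refine lt_of_le_of_ne (sub_nonneg.2 (hle π)) fun h0 => ?_
    have hconst : ∀ x, φ x = μ := by
      intro x
      have h1 := apply_eq_apply_norm hper hev x
      have h2 := hmon (norm_coe_mem_Icc x) (right_mem_Icc.2 Real.pi_pos.le) (norm_coe_mem_Icc x).2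
      simp only at h1 h2
      linarith [hle x]
    have h3 := hsol.integral_eq_zero hr hμ hc
    simp only [hconst, intervalIntegral.integral_const, smul_eq_mul] at h3
    have : 0 < (π - -π) * μ := mul_pos (by linarith [Real.pi_pos]) hμ
    linarith
  · rw [hsol.sq_sub_eq hr hmax, hconv, hconv]
    ring

end IsSteadySolution

theorem theorem4p6 (r μ : ℝ) (hr : 1 < r) (hμ : 0 < μ) (φ : ℝ → ℝ)
    (hsol : IsSteadySolution r μ φ)
    (heven : Function.Even φ)
    (hmono : MonotoneOn φ (Icc (-π) 0))
    (hle : ∀ x, φ x ≤ μ)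
    (hmax : φ 0 = μ) :
    (ContDiffOn ℝ ∞ φ {x : ℝ | ∀ k : ℤ, x ≠ 2 * π * k} ∧ StrictMonoOn φ (Ioo (-π) 0)) ∧
    ((∃ C : NNReal, LipschitzWith C φ) ∧ ∫ x in (-π)..π, φ x = 0) ∧
    (∃ c > 0, ∃ C > 0, ∃ δ > 0, ∀ x : ℝ, |x| < δ →
      c * |x| ≤ μ - φ x ∧ μ - φ x ≤ C * |x|) := by
  have H := hsol.isCrestProfile hr hμ heven hmono hle hmax
  have hφ : φ = fun x => μ - (μ - φ x) := by funext x; ring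
  refine ⟨⟨fun x hx => ?_, fun x hx y hy hxy => ?_⟩, ⟨?_, ?_⟩, ?_⟩
  · have hcos : Real.cos x ≠ 1 := by
      intro h
      obtain ⟨k, hk⟩ := (Real.cos_eq_one_iff x).1 h
      exact hx k (by rw [← hk]; ring)
    rw [hφ]
    exact (contDiffAt_const.sub (H.contDiffAt_of_cos_ne_one hr hcos)).contDiffWithinAt
  · have h := H.strictMonoOn hr (a := -y) (b := -x) ⟨by linarith [hy.2], by linarith [hy.1]⟩
      ⟨by linarith [hx.2], by linarith [hx.1]⟩ (by linarith)
    simp only [heven x, heven y] at h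
    linarith
  · obtain ⟨C, hC⟩ := H.exists_lipschitzWith hr
    refine ⟨C, LipschitzWith.of_dist_le_mul fun x y => ?_⟩
    have h := hC.dist_le_mul x y
    rwa [dist_sub_left] at h
  · exact hsol.integral_eq_zero hr hμ (hsol.continuous hr hle hmax)
  · obtain ⟨c, hc, hlow⟩ := H.exists_mul_le hr
    obtain ⟨C, hC, hup⟩ := H.exists_le_mul hr
    refine ⟨c, hc, C, hC, π, Real.pi_pos, fun x hx => ?_⟩
    have hφx : φ x = φ |x| := by
      rcases abs_choice x with h | h
      · rw [h]
      · rw [h, heven]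
    rw [hφx]
    exact ⟨hlow _ ⟨abs_nonneg x, hx.le⟩, hup _ ⟨abs_nonneg x, hx.le⟩⟩
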